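/- Conventions. Let $R$ be a commutative ring with unit. A dga is an $\mathbb N$-graded $R$-module with a differential $d$ of degree $+1$, $d^2=0$, and a unital multiplication of degree $0$, not necessarily associative, satisfying $d(xy)=d(x)\,y+(-1)^{|x|}x\,d(y)$. Let $A$ be an associative dga which is $1$-reduced, i.e. $A^0=R\cdot 1\cong R$ and $A^1=0$, and put $\bar A=A^{>0}$. The bar construction $BA$ is the tensor coalgebra on $s^{-1}\bar A$, with $|\bar a|=|a|-1$, deconcatenation coproduct, and differential $$d[\bar a_1|\cdots|\bar a_n]=-\sum_{i}(-1)^{\varepsilon_{i-1}}[\bar a_1|\cdots|\overline{da_i}|\cdots|\bar a_n]-\sum_{i<n}(-1)^{\varepsilon_i}[\bar a_1|\cdots|\overline{a_ia_{i+1}}|\cdots|\bar a_n],\qquad \varepsilon_i=|\bar a_1|+\cdots+|\bar a_i| .$$ A Hirsch algebra is a $1$-reduced associative dga $A$ with multilinear maps $E_{p,q}:A^{\otimes p}\otimes A^{\otimes q}\to A$ ($p,q\ge 0$, $p+q>0$) such that (i) $E_{p,q}$ has degree $1-p-q$; (ii) $E_{1,0}=\mathrm{Id}=E_{0,1}$,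 and $E_{p,0}=0=E_{0,q}$ for $p,q>1$; moreover, for $p+q\ge2$, $E_{p,q}$ vanishes whenever one of its arguments is $1$; (iii) the homomorphism $E:BA\otimes BA\to A$, $E([\bar a_1|\cdots|\bar a_p]\otimes[\bar b_1|\cdots|\bar b_q])=E_{p,q}(a_1,\dots,a_p;b_1,\dots,b_q)$ (with $E([\,]\otimes[\,])=0$), is a twisting element in the dga $(\mathrm{Hom}(BA\otimes BA,A),\nabla,\smile)$: $\nabla E=-E\smile E$ (with Koszul signs, so that $\nabla E=dE+Ed$). Let $\circ$ be the product $BA\otimes BA\to BA$ that is the comultiplicative extension of $E$. The acyclic bar construction is $B(A;A)=A\otimes BA$ with total grading and the differential $$d(a_0\otimes[\bar a_1|\cdots|\bar a_n])=da_0\otimes[\bar a_1|\cdots|\bar a_n]+(-1)^{|a_0|}a_0\otimes d[\bar a_1|\cdots|\bar a_n]-(-1)^{|a_0|}a_0a_1\otimes[\bar a_2|\cdots|\bar a_n]$$ (without the last term if $n=0$). Statement. For every Hirsch algebra $A$, the preceding formula for $d$, and the formula $$(a_0\otimes[\bar a_1|\cdots|\bar a_n])\,(b_0\otimes[\bar b_1|\cdots|\bar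 b_m])=\sum_{\substack{0\le p\le n\\ 1\le q\le m+1}}(-1)^{\epsilon}\,a_0\,E_{p,q}(a_1,\dots,a_p;b_0,b_1,\dots,b_{q-1})\otimes[\bar a_{p+1}|\cdots|\bar a_n]\circ[\bar b_q|\cdots|\bar b_m],$$ $$\epsilon=|\bar a_1|+\cdots+|\bar a_p|+\bigl(|\bar a_{p+1}|+\cdots+|\bar a_n|\bigr)\bigl(|b_0|+|\bar b_1|+\cdots+|\bar b_{q-1}|\bigr),$$ for homogeneous $a_0,b_0\in A$ and $a_i,b_j\in\bar A$ ($i,j\ge1$), determine unique well-defined $R$-(bi)linear maps on $B(A;A)$, and with them $B(A;A)$ is a dga with unit $1\otimes[\,]$. -/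

import Mathlib

open scoped TensorProduct

noncomputable section

/-- A dga in the not necessarily associative sense: a module `B`, graded by the submodules `gr n`
(`n ≥ 0`), with a unital product of degree `0` and a differential of degree `+1` which is a graded
derivation. -/
structure IsDGA {R B : Type*} [CommRing R] [AddCommGroup B] [Module R B]
    (gr : ℕ → Submodule R B) (d : B →ₗ[R] B) (mul : B →ₗ[R] B →ₗ[R] B) (one : B) : Prop where
  internal : DirectSum.IsInternal gr
  one_mem : one ∈ gr 0
  one_mul : ∀ x, mul one x = x
  mul_one : ∀ x, mul x one = x
  mul_mem : ∀ m n x y, x ∈ gr m → y ∈ gr n → mul x y ∈ gr (m + n)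
  d_mem : ∀ n x, x ∈ gr n → d x ∈ gr (n + 1)
  d_d : ∀ x, d (d x) = 0
  leibniz : ∀ n x y, x ∈ gr n → d (mul x y) = mul (d x) y + (-1 : R) ^ n • mul x (d y)

/-- A homogeneous element `val` of positive degree `bdeg + 1`; thus `bdeg` is the degree of the
desuspended letter `[val]` of the bar construction. -/
structure Letter {R A : Type*} [CommRing R] [Ring A] [Algebra R A] (gr : ℕ → Submodule R A) where
  bdeg : ℕ
  val : A
  mem : val ∈ gr (bdeg + 1)

section Words

variable {R A : Type*} [CommRing R] [Ring A] [Algebra R A] {gr : ℕ → Submodule R A}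

/-- The elements `a₁, …, aₙ` underlying a list of letters. -/
def vals (l : List (Letter gr)) : List A := l.map Letter.val

/-- The degree `|a₁| + ⋯ + |aₙ| - n` of the bar word `[a₁|…|aₙ]`. -/
def bdeg (l : List (Letter gr)) : ℕ := (l.map Letter.bdeg).sum

/-- `barD d [a₁, …, aₙ] f` is the value of the multilinear function `f` of words on
the bar differential
`d[a₁|…|aₙ] = - ∑ i, (-1)^(ε (i-1)) [a₁|…|d aᵢ|…|aₙ] - ∑ i < n, (-1)^(ε i) [a₁|…|aᵢ aᵢ₊₁|…|aₙ]`,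
where `ε i = bdeg [a₁, …, aᵢ]`; it is written as a recursion on the first letter. -/
def barD (d : A →ₗ[R] A) {N : Type*} [AddCommGroup N] [Module R N] :
    List (Letter gr) → (List A → N) → N
  | [], _ => 0
  | [x], f => -f [d x.val]
  | x :: y :: l, f =>
      -f (d x.val :: y.val :: vals l)
      - (-1 : R) ^ x.bdeg • f (x.val * y.val :: vals l)
      + (-1 : R) ^ x.bdeg • barD d (y :: l) (fun w => f (x.val :: w))

/-- The value on `[a₁|…|aₚ] ⊗ [b₁|…|b_q]` of `∇ f = d ∘ f + f ∘ d`, for a homomorphism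
`f : BA ⊗ BA → A` of degree `1`, where `BA ⊗ BA` has the tensor product differential. -/
def nabla (d : A →ₗ[R] A) (f : List A → List A → A) (a b : List (Letter gr)) : A :=
  d (f (vals a) (vals b))
    + (barD d a (fun w => f w (vals b)) + (-1 : R) ^ bdeg a • barD d b (fun w => f (vals a) w))

/-- The value on `[a₁|…|aₚ] ⊗ [b₁|…|b_q]` of the product `f ⌣ g` of homomorphisms
`f, g : BA ⊗ BA → A` of degree `1`, where `BA` has the deconcatenation coproduct and `BA ⊗ BA` has
the tensor product coproduct. The Koszul sign comes from interchanging the second part of `a` with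
the first part of `b`, and `g` with the first parts of `a` and `b`. -/
def cup (f g : List A → List A → A) (a b : List (Letter gr)) : A :=
  ∑ i ∈ Finset.range (a.length + 1), ∑ j ∈ Finset.range (b.length + 1),
    (-1 : R) ^ (bdeg (a.drop i) * bdeg (b.take j) + (bdeg (a.take i) + bdeg (b.take j))) •
      (f (vals (a.take i)) (vals (b.take j)) * g (vals (a.drop i)) (vals (b.drop j)))

end Words

/-- The value `E_{p,q}(a₁, …, aₚ; b₁, …, b_q)` of a family of operations on lists of arguments. -/
def evalLists {R A : Type*} [CommRing R] [Ring A] [Algebra R A]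
    (E : ∀ p q : ℕ, MultilinearMap R (fun _ : Fin p => A) (MultilinearMap R (fun _ : Fin q => A) A))
    (a b : List A) : A :=
  E a.length b.length a.get b.get

/-- Hirsch algebra structures on an associative unital `R`-algebra `A`. -/
structure HirschAlgebra (R A : Type*) [CommRing R] [Ring A] [Algebra R A] where
  gr : ℕ → Submodule R A
  d : A →ₗ[R] A
  isDGA : IsDGA gr d (LinearMap.mul R A) 1
  /-- `A` is `1`-reduced: `A⁰ = R` and `A¹ = 0`. -/
  unit_injective : Function.Injective (algebraMap R A)
  gr_zero : gr 0 = LinearMap.range (Algebra.linearMap R A)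
  gr_one : gr 1 = ⊥
  /-- The operations `E_{p,q}`. -/
  E : ∀ p q : ℕ, MultilinearMap R (fun _ : Fin p => A) (MultilinearMap R (fun _ : Fin q => A) A)
  /-- `E_{p,q}` has degree `1 - p - q`. -/
  E_mem : ∀ (p q : ℕ) (α : Fin p → ℕ) (β : Fin q → ℕ) (a : Fin p → A) (b : Fin q → A),
    (∀ i, a i ∈ gr (α i)) → (∀ j, b j ∈ gr (β j)) →
    ∀ n, n + p + q = (∑ i, α i) + (∑ j, β j) + 1 → E p q a b ∈ gr n
  E_one_zero : ∀ a b, E 1 0 a b = a 0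
  E_zero_one : ∀ a b, E 0 1 a b = b 0
  E_left : ∀ p, p ≠ 1 → E p 0 = 0
  E_right : ∀ q, q ≠ 1 → E 0 q = 0
  /-- Normalization: apart from `E_{1,0}` and `E_{0,1}`, the operations come from operations on
  the augmentation ideal, that is, they vanish if some argument is `1`. -/
  E_unit_left : ∀ p q, 2 ≤ p + q → ∀ a b, (∃ i, a i = 1) → E p q a b = 0
  E_unit_right : ∀ p q, 2 ≤ p + q → ∀ a b, (∃ j, b j = 1) → E p q a b = 0
  /-- `E : BA ⊗ BA → A` is a twisting element: `∇ E = - E ⌣ E`. -/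
  twisting : ∀ a b : List (Letter gr),
    nabla d (evalLists E) a b = -cup (evalLists E) (evalLists E) a b

/-- The augmentation quotient `A / R·1`, the desuspension of which generates `BA`. As `A⁰ = R·1`,
it is identified with the part of `A` of positive degree. -/
abbrev Reduced (R A : Type*) [CommRing R] [Ring A] [Algebra R A] : Type _ :=
  A ⧸ LinearMap.range (Algebra.linearMap R A)

/-- The module underlying the bar construction `BA`: the direct sum of all tensor powers of the
(desuspended) augmentation quotient. -/
abbrev Bar (R A : Type*) [CommRing R] [Ring A] [Algebra R A] : Type _ :=
  TensorAlgebra R (Reduced R A)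

/-- The module underlying the acyclic bar construction `B(A; A) = A ⊗ BA`. -/
abbrev AcyclicBar (R A : Type*) [CommRing R] [Ring A] [Algebra R A] : Type _ :=
  A ⊗[R] Bar R A

/-- The word of length one `[a]`. -/
def barLetter (R : Type*) {A : Type*} [CommRing R] [Ring A] [Algebra R A] (a : A) : Bar R A :=
  TensorAlgebra.ι R (Submodule.Quotient.mk a)

/-- The word `[a₁|…|aₙ]`. -/
def barWord (R : Type*) {A : Type*} [CommRing R] [Ring A] [Algebra R A] (l : List A) : Bar R A :=
  (l.map (barLetter R)).prod

namespace HirschAlgebra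

variable {R A : Type*} [CommRing R] [Ring A] [Algebra R A] (H : HirschAlgebra R A)

/-- `E_{p,q}(a₁, …, aₚ; b₁, …, b_q)`. -/
def op (a b : List A) : A := evalLists H.E a b

/-- The product `[a₁|…|aₙ] ∘ [b₁|…|bₘ]` in `BA`, that is, the comultiplicative extension of
`E : BA ⊗ BA → A`. It is the signed sum of all words
`[E(a₁, …; b₁, …)|E(…; …)|…|E(…, aₙ; …, bₘ)]` over the decompositions of the two arguments into the
same number of consecutive blocks; here, the first pair of blocks is split off. -/
def circ (a b : List (Letter H.gr)) : Bar R A :=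
  if a.length + b.length = 0 then 1 else
  ∑ i : Fin (a.length + 1), ∑ j : Fin (b.length + 1),
    if 0 < i.val + j.val then
      (-1 : R) ^ (bdeg (a.drop i) * bdeg (b.take j)) •
        (barLetter R (H.op (vals (a.take i)) (vals (b.take j))) * circ (a.drop i) (b.drop j))
    else 0
termination_by a.length + b.length
decreasing_by
  have _hi := i.isLt
  have _hj := j.isLt
  simp only [List.length_drop]
  omega

/-- The total grading of `B(A; A)`: `a₀ ⊗ [a₁|…|aₙ]` has degree
`|a₀| + (|a₁| - 1) + ⋯ + (|aₙ| - 1)`. -/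
def acyclicBarGr (k : ℕ) : Submodule R (AcyclicBar R A) :=
  Submodule.span R {z | ∃ (i : ℕ) (a₀ : A) (a : List (Letter H.gr)),
    a₀ ∈ H.gr i ∧ i + bdeg a = k ∧ z = a₀ ⊗ₜ[R] barWord R (vals a)}

/-- The differential of `B(A; A)`: `d(a₀ ⊗ x) = d a₀ ⊗ x + (-1)^|a₀| a₀ ⊗ d x
- (-1)^|a₀| a₀ a₁ ⊗ [a₂|…|aₙ]` for `x = [a₁|…|aₙ]`, without the last term if `n = 0`. -/
def IsAcyclicBarDifferential (D : AcyclicBar R A →ₗ[R] AcyclicBar R A) : Prop :=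
  ∀ (k : ℕ) (a₀ : A), a₀ ∈ H.gr k →
    D (a₀ ⊗ₜ[R] barWord R []) = H.d a₀ ⊗ₜ[R] barWord R [] ∧
    ∀ (a₁ : Letter H.gr) (a : List (Letter H.gr)),
      D (a₀ ⊗ₜ[R] barWord R (vals (a₁ :: a))) =
        H.d a₀ ⊗ₜ[R] barWord R (vals (a₁ :: a))
        + (-1 : R) ^ k • a₀ ⊗ₜ[R] barD H.d (a₁ :: a) (barWord R)
        - (-1 : R) ^ k • (a₀ * a₁.val) ⊗ₜ[R] barWord R (vals a)

/-- The twisted multiplication of `B(A; A)`: with `j = q - 1`,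
`(a₀ ⊗ [a₁|…|aₙ]) (b₀ ⊗ [b₁|…|bₘ]) =
∑ p j, (-1)^ε a₀ E_{p,j+1}(a₁, …, aₚ; b₀, b₁, …, b_j) ⊗ [aₚ₊₁|…|aₙ] ∘ [b_{j+1}|…|bₘ]`. -/
def IsTwistedMul (M : AcyclicBar R A →ₗ[R] AcyclicBar R A →ₗ[R] AcyclicBar R A) : Prop :=
  ∀ (a₀ : A) (a : List (Letter H.gr)) (k : ℕ) (b₀ : A) (b : List (Letter H.gr)), b₀ ∈ H.gr k →
    M (a₀ ⊗ₜ[R] barWord R (vals a)) (b₀ ⊗ₜ[R] barWord R (vals b)) =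
      ∑ p ∈ Finset.range (a.length + 1), ∑ j ∈ Finset.range (b.length + 1),
        (-1 : R) ^ (bdeg (a.take p) + bdeg (a.drop p) * (k + bdeg (b.take j))) •
          ((a₀ * H.op (vals (a.take p)) (b₀ :: vals (b.take j))) ⊗ₜ[R]
            H.circ (a.drop p) (b.drop j))

end HirschAlgebra

end

/-! The product on `B(A; A)` is governed by the product `∘` of `BA` through the map `uncons`,
`[a₁|…|aₙ] ↦ a₁ ⊗ [a₂|…|aₙ]`. It identifies the words of positive length with `Ā ⊗ BA` and
anticommutes with the differentials (`acyclicDiff_uncons`). For `b₀` of positive degree, `(1 ⊗ w)(b₀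
⊗ b)` is, up to the sign `(-1)^|w|`, the image under `uncons` of `w ∘ [b₀|b]`, minus the terms whose
first block takes nothing from the right factor. In those only `E_{1,0}` survives, so they add up to
`w₁ ⊗ ([w₂|…] ∘ [b₀|b])`. For `b₀ = 1`, normalization leaves `1 ⊗ (w ∘ b)`.

The Leibniz rule for `1 ⊗ w` is then formal once `∘` is a chain map. The subtracted terms alone do
not satisfy it; their defect is the product of `uncons w` and `uncons y`, which is what the summand
`-uncons w` of `d(1 ⊗ w) = 1 ⊗ dw - uncons w` demands (`acyclicDiff_rightCirc_uncons`,
`acyclicDiff_wordMul`). A general left factor `a₀ ⊗ w` follows because `B(A; A)` is a left dg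
`A`-module and the product is left `A`-linear.

That `∘` is a chain map (`barDiff_circ`) follows from the twisting equation by induction on length.
Its linear terms assemble into the differentials of the two factors, the bar differential being a
coderivation. Its quadratic terms `E ⌣ E` cancel the merging of the first two output letters, by
coassociativity (`circ_cup_cancel`).

All maps are well defined because a function of words that is linear in each homogeneous letter
extends to `BA` (`wordLift`), and unique because words span. Associativity of `∘` plays no role. -/

/-- The sum of `G u v` over all splittings `l = u ++ v`. -/
def splitSum {α N : Type*} [AddCommMonoid N] : List α → (List α → List α → N) → N
  | [], G => G [] []
  | x :: l, G => G [] (x :: l) + splitSum l (fun u v => G (x :: u) v)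

/-! ### Sums over deconcatenations of a word. -/

section SplitSum

variable {α β N N' : Type*} [AddCommMonoid N] [AddCommMonoid N']

theorem splitSum_eq_sum (l : List α) (G : List α → List α → N) :
    splitSum l G = ∑ i ∈ Finset.range (l.length + 1), G (l.take i) (l.drop i) := by
  induction l generalizing G with
  | nil => simp [splitSum]
  | cons x l ih =>
    rw [splitSum, ih, List.length_cons, Finset.sum_range_succ' _ (l.length + 1), add_comm]
    simp

theorem splitSum_congr {l : List α} {G G' : List α → List α → N}
    (h : ∀ u v, u ++ v = l → G u v = G' u v) : splitSum l G = splitSum l G' := by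
  simp only [splitSum_eq_sum]
  exact Finset.sum_congr rfl fun i _ => h _ _ (List.take_append_drop i l)

theorem splitSum_add (l : List α) (G G' : List α → List α → N) :
    splitSum l (fun u v => G u v + G' u v) = splitSum l G + splitSum l G' := by
  simp only [splitSum_eq_sum, Finset.sum_add_distrib]

@[simp] theorem splitSum_zero (l : List α) :
    splitSum l (fun _ _ => (0 : N)) = 0 := by
  simp only [splitSum_eq_sum, Finset.sum_const_zero]

theorem map_splitSum {F : Type*} [FunLike F N N'] [AddMonoidHomClass F N N'] (φ : F)
    (l : List α) (G : List α → List α → N) :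
    φ (splitSum l G) = splitSum l (fun u v => φ (G u v)) := by
  simp only [splitSum_eq_sum, map_sum]

theorem splitSum_comm (l : List α) (m : List β) (G : List α → List α → List β → List β → N) :
    splitSum l (fun u v => splitSum m (fun p q => G u v p q)) =
      splitSum m (fun p q => splitSum l (fun u v => G u v p q)) := by
  simp only [splitSum_eq_sum]
  exact Finset.sum_comm

/-- Coassociativity of deconcatenation: both sides run over the cuts of `l` into three consecutive
pieces. -/
theorem splitSum_assoc (l : List α) (G : List α → List α → List α → N) :
    splitSum l (fun p w => splitSum p (fun u v => G u v w)) =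
      splitSum l (fun u q => splitSum q (fun v w => G u v w)) := by
  induction l generalizing G with
  | nil => simp [splitSum]
  | cons x l ih => simp only [splitSum, splitSum_add, ih (fun u v w => G (x :: u) v w), add_assoc]

theorem splitSum_smul {R : Type*} [Monoid R] [DistribMulAction R N] (c : R) (l : List α)
    (G : List α → List α → N) :
    splitSum l (fun u v => c • G u v) = c • splitSum l G := by
  simp only [splitSum_eq_sum, Finset.smul_sum]

end SplitSum

theorem splitSum_sub {α N : Type*} [AddCommGroup N] (l : List α) (G G' : List α → List α → N) :
    splitSum l (fun u v => G u v - G' u v) = splitSum l G - splitSum l G' := by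
  simp only [splitSum_eq_sum, Finset.sum_sub_distrib]

theorem splitSum_neg {α N : Type*} [AddCommGroup N] (l : List α) (G : List α → List α → N) :
    splitSum l (fun u v => -G u v) = -splitSum l G := by
  simp only [splitSum_eq_sum, Finset.sum_neg_distrib]

/-! ### Linear maps on a tensor algebra by recursion on the first letter. -/

section TensorAlgebraRec

variable {R V N : Type*} [CommRing R] [AddCommGroup V] [Module R V] [AddCommGroup N] [Module R N]

/-- The action of the tensor algebra on pairs used for recursive definitions. -/
def TensorAlgebra.leftRecAux (φ : V →ₗ[R] TensorAlgebra R V →ₗ[R] N) (ψ : V →ₗ[R] N →ₗ[R] N) :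
    TensorAlgebra R V →ₐ[R] Module.End R (TensorAlgebra R V × N) :=
  TensorAlgebra.lift R (LinearMap.mk₂ R
    (fun v p => (TensorAlgebra.ι R v * p.1, φ v p.1 + ψ v p.2))
    (fun v v' p => by ext <;> simp [add_mul, add_add_add_comm])
    (fun c v p => by ext <;> simp)
    (fun v p p' => by ext <;> simp [mul_add, add_add_add_comm])
    (fun c v p => by ext <;> simp))

/-- The first coordinate carries the word read so far; this is what lets the recursion step `φ v w`
depend on the remaining word `w` and not only on the value at `w`. -/
theorem TensorAlgebra.leftRecAux_fst (φ : V →ₗ[R] TensorAlgebra R V →ₗ[R] N)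
    (ψ : V →ₗ[R] N →ₗ[R] N) (w : TensorAlgebra R V) (p : TensorAlgebra R V × N) :
    (TensorAlgebra.leftRecAux φ ψ w p).1 = w * p.1 := by
  induction w using TensorAlgebra.induction generalizing p with
  | algebraMap r => simp [Algebra.smul_def, Module.algebraMap_end_apply]
  | ι v => simp [TensorAlgebra.leftRecAux]
  | mul a b ha hb => simp [ha, hb, mul_assoc]
  | add a b ha hb => simp [ha, hb, add_mul]

/-- The linear map `F` on the tensor algebra with `F 1 = n₀` and
`F (v * w) = φ v w + ψ v (F w)`. -/
def TensorAlgebra.leftRec (n₀ : N) (φ : V →ₗ[R] TensorAlgebra R V →ₗ[R] N)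
    (ψ : V →ₗ[R] N →ₗ[R] N) : TensorAlgebra R V →ₗ[R] N :=
  LinearMap.snd R _ _ ∘ₗ LinearMap.applyₗ (1, n₀) ∘ₗ (TensorAlgebra.leftRecAux φ ψ).toLinearMap

theorem TensorAlgebra.leftRec_one (n₀ : N) (φ : V →ₗ[R] TensorAlgebra R V →ₗ[R] N)
    (ψ : V →ₗ[R] N →ₗ[R] N) : TensorAlgebra.leftRec n₀ φ ψ 1 = n₀ := by
  simp [TensorAlgebra.leftRec]

theorem TensorAlgebra.leftRec_ι_mul (n₀ : N) (φ : V →ₗ[R] TensorAlgebra R V →ₗ[R] N)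
    (ψ : V →ₗ[R] N →ₗ[R] N) (v : V) (w : TensorAlgebra R V) :
    TensorAlgebra.leftRec n₀ φ ψ (TensorAlgebra.ι R v * w) =
      φ v w + ψ v (TensorAlgebra.leftRec n₀ φ ψ w) := by
  have h := TensorAlgebra.leftRecAux_fst φ ψ w (1, n₀)
  have h2 : TensorAlgebra.leftRecAux φ ψ (TensorAlgebra.ι R v) =
    LinearMap.mk₂ R
    (fun v p => (TensorAlgebra.ι R v * p.1, φ v p.1 + ψ v p.2)) _ _ _ _ v :=
    TensorAlgebra.lift_ι_apply _ _
  simp [TensorAlgebra.leftRec, h2, h]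

end TensorAlgebraRec

/-! ### Linear maps out of a graded module. -/

section GradedLift

variable {R A N : Type*} [CommRing R] [AddCommGroup A] [Module R A] [AddCommGroup N] [Module R N]
  {gr : ℕ → Submodule R A}

/-- The linear map given by linear maps on the components of an internal direct sum. -/
noncomputable def gradedLift (h : DirectSum.IsInternal gr) (φ : ∀ k, gr k →ₗ[R] N) : A →ₗ[R] N :=
  DirectSum.toModule R ℕ N φ ∘ₗ
    (LinearEquiv.ofBijective (DirectSum.coeLinearMap gr) h).symm.toLinearMap

theorem gradedLift_apply (h : DirectSum.IsInternal gr) (φ : ∀ k, gr k →ₗ[R] N) {k : ℕ} {x : A}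
    (hx : x ∈ gr k) : gradedLift h φ x = φ k ⟨x, hx⟩ := by
  have : (LinearEquiv.ofBijective (DirectSum.coeLinearMap gr) h).symm x =
      DirectSum.lof R ℕ (fun k => gr k) k ⟨x, hx⟩ := by
    rw [LinearEquiv.symm_apply_eq]
    exact (DirectSum.coeLinearMap_lof gr k ⟨x, hx⟩).symm
  simp [gradedLift, this]

theorem graded_induction (h : DirectSum.IsInternal gr) {p : A → Prop} (h0 : p 0)
    (hadd : ∀ x y, p x → p y → p (x + y)) (hgr : ∀ k, ∀ x ∈ gr k, p x) (x : A) : p x := by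
  have hx : x ∈ ⨆ k, gr k := by rw [h.submodule_iSup_eq_top]; trivial
  induction hx using Submodule.iSup_induction' with
  | mem k x hx => exact hgr k x hx
  | zero => exact h0
  | add x y _ _ hx hy => exact hadd x y hx hy

end GradedLift

/-! ### Linear maps on `BA` from functions of words that are linear in each letter. -/

section LetterLift

variable {R A N N' : Type*} [CommRing R] [Ring A] [Algebra R A] [AddCommGroup N] [Module R N]
  [AddCommGroup N'] [Module R N'] {gr : ℕ → Submodule R A}

/-- The letter given by an element of `gr (n + 1)`. -/
def mkLetter {n : ℕ} (x : gr (n + 1)) : Letter gr := ⟨n, x, x.2⟩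

@[simp] theorem mkLetter_bdeg {n : ℕ} (x : gr (n + 1)) : (mkLetter x).bdeg = n := rfl
@[simp] theorem mkLetter_val {n : ℕ} (x : gr (n + 1)) : (mkLetter x).val = x := rfl

@[simp] theorem vals_nil : vals ([] : List (Letter gr)) = [] := rfl
@[simp] theorem vals_cons (x : Letter gr) (l : List (Letter gr)) :
    vals (x :: l) = x.val :: vals l := rfl
@[simp] theorem vals_append (l l' : List (Letter gr)) : vals (l ++ l') = vals l ++ vals l' :=
  List.map_append
@[simp] theorem length_vals (l : List (Letter gr)) : (vals l).length = l.length :=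
  List.length_map _
@[simp] theorem bdeg_nil : bdeg ([] : List (Letter gr)) = 0 := rfl
@[simp] theorem bdeg_cons (x : Letter gr) (l : List (Letter gr)) :
    bdeg (x :: l) = x.bdeg + bdeg l := by simp [bdeg]
@[simp] theorem bdeg_append (l l' : List (Letter gr)) : bdeg (l ++ l') = bdeg l + bdeg l' := by
  simp [bdeg]

@[simp] theorem barWord_nil : barWord R ([] : List A) = 1 := rfl
@[simp] theorem barWord_cons (x : A) (l : List A) :
    barWord R (x :: l) = barLetter R x * barWord R l := by simp [barWord]

/-- The linear map `a ↦ [a]`. -/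
def barLetterₗ (R A : Type*) [CommRing R] [Ring A] [Algebra R A] : A →ₗ[R] Bar R A :=
  TensorAlgebra.ι R ∘ₗ Submodule.mkQ _

@[simp] theorem barLetterₗ_apply (a : A) : barLetterₗ R A a = barLetter R a := rfl

theorem barLetter_zero : barLetter R (0 : A) = 0 := map_zero (barLetterₗ R A)

theorem barLetter_one : barLetter R (1 : A) = 0 := by
  have : (Submodule.Quotient.mk 1 : Reduced R A) = 0 :=
    (Submodule.Quotient.mk_eq_zero _).2 ⟨1, by simp⟩
  simp [barLetter, this]

/-- Linearity of a function of words in the letter between `l₁` and `l₂`. -/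
def LinearAt (g : List (Letter gr) → N) (l₁ l₂ : List (Letter gr)) : Prop :=
  ∀ n, ∃ φ : gr (n + 1) →ₗ[R] N, ∀ x, g (l₁ ++ mkLetter x :: l₂) = φ x

/-- The functions of words that are linear in each letter. -/
def letterMultilinear (gr : ℕ → Submodule R A) (N : Type*) [AddCommGroup N] [Module R N] :
    Submodule R (List (Letter gr) → N) where
  carrier := {g | ∀ l₁ l₂, LinearAt g l₁ l₂}
  add_mem' := fun {f g} hf hg l₁ l₂ n => by
    obtain ⟨φ, hφ⟩ := hf l₁ l₂ n
    obtain ⟨ψ, hψ⟩ := hg l₁ l₂ n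
    exact ⟨φ + ψ, fun x => by simp [hφ, hψ]⟩
  zero_mem' := fun _ _ _ => ⟨0, fun _ => rfl⟩
  smul_mem' := fun c f hf l₁ l₂ n => by
    obtain ⟨φ, hφ⟩ := hf l₁ l₂ n
    exact ⟨c • φ, fun x => by simp [hφ]⟩

theorem LinearAt.of_add_smul {g : List (Letter gr) → N} {l₁ l₂ : List (Letter gr)}
    (hadd : ∀ (n : ℕ) (x y : gr (n + 1)), g (l₁ ++ mkLetter (x + y) :: l₂) =
      g (l₁ ++ mkLetter x :: l₂) + g (l₁ ++ mkLetter y :: l₂))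
    (hsmul : ∀ (n : ℕ) (c : R) (x : gr (n + 1)), g (l₁ ++ mkLetter (c • x) :: l₂) =
      c • g (l₁ ++ mkLetter x :: l₂)) : LinearAt g l₁ l₂ := fun n =>
  ⟨{ toFun := fun x => g (l₁ ++ mkLetter x :: l₂), map_add' := hadd n, map_smul' := hsmul n },
    fun _ => rfl⟩

/-- The letter `n` component of the action below. -/
noncomputable def appendLetterAux (n : ℕ) :
    gr n →ₗ[R] letterMultilinear gr N →ₗ[R] letterMultilinear gr N :=
  match n with
  -- Degree `0` acts as zero, so the action kills `R·1` and descends to the reduced algebra.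
  | 0 => 0
  | n + 1 => LinearMap.mk₂ R
      (fun x g => ⟨fun l => g.1 (l ++ [mkLetter x]), fun l₁ l₂ m => by
        obtain ⟨φ, hφ⟩ := g.2 l₁ (l₂ ++ [mkLetter x]) m
        exact ⟨φ, fun y => by simp [← hφ]⟩⟩)
      (fun x y g => Subtype.ext <| funext fun l => by
        obtain ⟨φ, hφ⟩ := g.2 l [] n
        simp [hφ])
      (fun c x g => Subtype.ext <| funext fun l => by
        obtain ⟨φ, hφ⟩ := g.2 l [] n
        simp [hφ])
      (fun x g g' => rfl)
      (fun c x g => rfl)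

variable (hgr : DirectSum.IsInternal gr) (h0 : gr 0 = LinearMap.range (Algebra.linearMap R A))

include h0 in
theorem gradedLift_range_le_ker (φ : ∀ k, gr k →ₗ[R] N) (hφ : φ 0 = 0) :
    LinearMap.range (Algebra.linearMap R A) ≤ LinearMap.ker (gradedLift hgr φ) := by
  intro x hx
  rw [← h0] at hx
  rw [LinearMap.mem_ker, gradedLift_apply hgr _ hx, hφ, LinearMap.zero_apply]

/-- The linear map on the reduced algebra given by linear maps on the components of positive
degree. -/
noncomputable def reducedLift (φ : ∀ k, gr k →ₗ[R] N) (hφ : φ 0 = 0) : Reduced R A →ₗ[R] N :=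
  Submodule.liftQ _ (gradedLift hgr φ) (gradedLift_range_le_ker hgr h0 φ hφ)

theorem reducedLift_mk (φ : ∀ k, gr k →ₗ[R] N) (hφ : φ 0 = 0) {k : ℕ} {x : A} (hx : x ∈ gr k) :
    reducedLift hgr h0 φ hφ (Submodule.Quotient.mk x) = φ k ⟨x, hx⟩ :=
  gradedLift_apply hgr φ hx

/-- The action of the tensor algebra on multilinear functions of words by appending letters. -/
noncomputable def appendLetters (N : Type*) [AddCommGroup N] [Module R N] :
    Bar R A →ₐ[R] Module.End R (letterMultilinear gr N) :=
  TensorAlgebra.lift R (reducedLift (N := Module.End R (letterMultilinear gr N)) hgr h0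
    appendLetterAux rfl)

theorem appendLetters_barLetter (x : Letter gr) :
    appendLetters hgr h0 N (barLetter R x.val) = appendLetterAux (x.bdeg + 1) ⟨x.val, x.mem⟩ :=
  (TensorAlgebra.lift_ι_apply _ _).trans (reducedLift_mk hgr h0 _ _ x.mem)

/-- The leftmost letter acts last on `g`, hence is the first to be appended to `l'`, which preserves
the order of the word. At `l' = []` this recovers `g l`, and so extends `g` linearly to `BA`. -/
theorem appendLetters_barWord (l l' : List (Letter gr)) (g : letterMultilinear gr N) :
    (appendLetters hgr h0 N (barWord R (vals l)) g).1 l' = g.1 (l' ++ l) := by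
  induction l generalizing l' with
  | nil => simp
  | cons x l ih =>
    rw [vals_cons, barWord_cons, map_mul, appendLetters_barLetter]
    change (appendLetters hgr h0 N (barWord R (vals l)) g).1 (l' ++ [x]) = _
    rw [ih]
    simp

/-- The linear map on `BA` with prescribed values on words. -/
noncomputable def wordLift (g : List (Letter gr) → N) (hg : ∀ l₁ l₂, LinearAt g l₁ l₂) :
    Bar R A →ₗ[R] N :=
  LinearMap.proj [] ∘ₗ (letterMultilinear gr N).subtype ∘ₗ LinearMap.applyₗ ⟨g, hg⟩ ∘ₗ
    (appendLetters hgr h0 N).toLinearMap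

theorem wordLift_barWord (g : List (Letter gr) → N) (hg : ∀ l₁ l₂, LinearAt g l₁ l₂)
    (l : List (Letter gr)) : wordLift hgr h0 g hg (barWord R (vals l)) = g l :=
  appendLetters_barWord hgr h0 l [] ⟨g, hg⟩

include hgr h0 in
theorem barLetter_induction {p : Bar R A → Prop} (hz : p 0)
    (hadd : ∀ x y, p x → p y → p (x + y)) (h : ∀ x : Letter gr, p (barLetter R x.val)) (a : A) :
    p (barLetter R a) := by
  induction a using graded_induction hgr with
  | h0 => rwa [barLetter_zero]
  | hadd x y hx hy =>
    rw [← barLetterₗ_apply, map_add]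
    exact hadd _ _ hx hy
  | hgr k x hx =>
    cases k with
    | zero =>
      rw [h0] at hx
      obtain ⟨r, rfl⟩ := hx
      rw [Algebra.linearMap_apply, Algebra.algebraMap_eq_smul_one, ← barLetterₗ_apply, map_smul,
        barLetterₗ_apply, barLetter_one, smul_zero]
      exact hz
    | succ n => exact h ⟨n, x, hx⟩

-- The span of the words is stable under left multiplication by every element of the tensor algebra,
-- and it contains the empty word.
include hgr h0 in
theorem span_barWord :
    Submodule.span R (Set.range fun l : List (Letter gr) => barWord R (vals l)) = ⊤ := by
  set S := Submodule.span R (Set.range fun l : List (Letter gr) => barWord R (vals l))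
  have key : ∀ w z : Bar R A, z ∈ S → w * z ∈ S := by
    intro w
    induction w using TensorAlgebra.induction with
    | algebraMap r => intro z hz; rw [← Algebra.smul_def]; exact S.smul_mem r hz
    | ι v =>
      obtain ⟨a, rfl⟩ := Submodule.Quotient.mk_surjective _ v
      change ∀ z ∈ S, barLetter R a * z ∈ S
      refine barLetter_induction (p := fun b => ∀ z ∈ S, b * z ∈ S) hgr h0 ?_ ?_ ?_ a
      · intro z _; simp
      · intro x y hx hy z hz; rw [add_mul]; exact S.add_mem (hx z hz) (hy z hz)
      · intro x z hz
        induction hz using Submodule.span_induction with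
        | mem z hz =>
          obtain ⟨l, rfl⟩ := hz
          exact Submodule.subset_span ⟨x :: l, by simp⟩
        | zero => simp
        | add z z' _ _ hz hz' => rw [mul_add]; exact S.add_mem hz hz'
        | smul c z _ hz => rw [mul_smul_comm]; exact S.smul_mem c hz
    | mul a b ha hb => intro z hz; rw [mul_assoc]; exact ha _ (hb z hz)
    | add a b ha hb => intro z hz; rw [add_mul]; exact S.add_mem (ha z hz) (hb z hz)
  rw [eq_top_iff]
  intro w _
  simpa using key w 1 (Submodule.subset_span ⟨[], rfl⟩)

include hgr h0 in
theorem bar_hom_ext {f g : Bar R A →ₗ[R] N}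
    (h : ∀ l : List (Letter gr), f (barWord R (vals l)) = g (barWord R (vals l))) : f = g :=
  LinearMap.ext_on (span_barWord hgr h0) (by rintro _ ⟨l, rfl⟩; exact h l)

include hgr h0 in
theorem acyclicBar_hom_ext {f g : AcyclicBar R A →ₗ[R] N}
    (h : ∀ k, ∀ a ∈ gr k, ∀ l : List (Letter gr),
      f (a ⊗ₜ barWord R (vals l)) = g (a ⊗ₜ barWord R (vals l))) : f = g := by
  refine TensorProduct.ext ?_
  ext1 a
  induction a using graded_induction hgr with
  | h0 => simp
  | hadd x y hx hy => rw [map_add, map_add, hx, hy]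
  | hgr k a ha => exact bar_hom_ext hgr h0 fun l => h k a ha l

end LetterLift

/-! ### Operations preserving linearity in a letter. -/

section LinearAt

variable {R A N N' α : Type*} [CommRing R] [Ring A] [Algebra R A] [AddCommGroup N] [Module R N]
  [AddCommGroup N'] [Module R N'] {gr : ℕ → Submodule R A} {l₁ l₂ : List (Letter gr)}

theorem LinearAt.zero : LinearAt (fun _ => (0 : N)) l₁ l₂ := fun _ => ⟨0, fun _ => rfl⟩

theorem LinearAt.congr {g g' : List (Letter gr) → N} (h : LinearAt g l₁ l₂)
    (hg : ∀ x, g' (l₁ ++ x :: l₂) = g (l₁ ++ x :: l₂)) : LinearAt g' l₁ l₂ := fun n => by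
  obtain ⟨φ, hφ⟩ := h n
  exact ⟨φ, fun x => by rw [hg, hφ]⟩

theorem LinearAt.add {g g' : List (Letter gr) → N} (h : LinearAt g l₁ l₂)
    (h' : LinearAt g' l₁ l₂) : LinearAt (fun l => g l + g' l) l₁ l₂ := fun n => by
  obtain ⟨φ, hφ⟩ := h n
  obtain ⟨ψ, hψ⟩ := h' n
  exact ⟨φ + ψ, fun x => by simp [hφ, hψ]⟩

theorem LinearAt.map {g : List (Letter gr) → N} (h : LinearAt g l₁ l₂) (F : N →ₗ[R] N') :
    LinearAt (fun l => F (g l)) l₁ l₂ := fun n => by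
  obtain ⟨φ, hφ⟩ := h n
  exact ⟨F ∘ₗ φ, fun x => by simp [hφ]⟩

/-- Linearity is tested with the degree of the varying letter fixed, so a coefficient depending on
the degree of the word is constant there. -/
theorem LinearAt.bdeg_smul {g : List (Letter gr) → N} (h : LinearAt g l₁ l₂) (c : ℕ → R) :
    LinearAt (fun l => c (bdeg l) • g l) l₁ l₂ := fun n => by
  obtain ⟨φ, hφ⟩ := h n
  exact ⟨c (bdeg l₁ + (n + bdeg l₂)) • φ, fun x => by simp [hφ]⟩

theorem LinearAt.splitSum_const (b : List α) {G : List (Letter gr) → List α → List α → N}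
    (h : ∀ u v, u ++ v = b → LinearAt (fun l => G l u v) l₁ l₂) :
    LinearAt (fun l => splitSum b (G l)) l₁ l₂ := by
  induction b generalizing G with
  | nil => exact h [] [] rfl
  | cons x b ih =>
    exact (h [] (x :: b) rfl).add
      (ih (G := fun l u v => G l (x :: u) v) fun u v huv => h (x :: u) v (by simp [huv]))

/-- A cut inside `l₁` leaves the varying letter in the right piece, a cut inside `l₂` leaves it in
the left piece; each kind of cut has its own hypothesis. -/
theorem LinearAt.of_splitSum {G : List (Letter gr) → List (Letter gr) → N}
    (h₁ : ∀ u v, u ++ v = l₁ → LinearAt (fun l => G u l) v l₂)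
    (h₂ : ∀ u v, u ++ v = l₂ → LinearAt (fun l => G l v) l₁ u) :
    LinearAt (fun l => splitSum l G) l₁ l₂ := by
  induction l₁ generalizing G with
  | nil =>
    -- With nothing before it, the varying letter is the head of `l`. Writing it as `l.take 1` makes
    -- the summands functions of the whole word.
    refine LinearAt.congr (g := fun l => G [] l + splitSum l.tail fun u v =>
      G (l.take 1 ++ u) v) ?_ fun x => by simp [splitSum]
    refine (h₁ [] [] rfl).add ?_
    refine LinearAt.congr (g := fun l => splitSum l₂ fun u v =>
      G (l.take 1 ++ u) v) ?_ fun x => by simp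
    refine LinearAt.splitSum_const _ fun u v huv n => ?_
    obtain ⟨φ, hφ⟩ := h₂ u v huv n
    exact ⟨φ, fun x => by simp [← hφ]⟩
  | cons y l₁ ih =>
    have h := (h₁ [] (y :: l₁) rfl)
    have h' := ih (G := fun u v => G (y :: u) v)
      (fun u v huv => h₁ (y :: u) v (by simp [huv]))
      (fun u v huv n => by
        obtain ⟨φ, hφ⟩ := h₂ u v huv n
        exact ⟨φ, fun x => by simp [← hφ]⟩)
    intro n
    obtain ⟨φ, hφ⟩ := h n
    obtain ⟨ψ, hψ⟩ := h' n
    exact ⟨φ + ψ, fun x => by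
      rw [LinearMap.add_apply, ← hφ, ← hψ]
      rfl⟩

end LinearAt

/-! ### Multilinearity of the operations on lists. -/

section EvalLists

variable {R A : Type*} [CommRing R] [Ring A] [Algebra R A]
  (E : ∀ p q : ℕ, MultilinearMap R (fun _ : Fin p => A) (MultilinearMap R (fun _ : Fin q => A) A))

theorem evalLists_eq {p q : ℕ} (a b : List A) (ha : a.length = p) (hb : b.length = q) :
    evalLists E a b = E p q (fun i => a.get (i.cast ha.symm)) (fun j => b.get (j.cast hb.symm)) := by
  subst ha hb
  rfl

/-- Inserting a letter becomes `Function.update`, the form in which multilinearity is available. -/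
theorem get_append_cons (l₁ l₂ : List A) (x : A) {p : ℕ}
    (h : (l₁ ++ x :: l₂).length = p) (h' : (l₁ ++ 0 :: l₂).length = p) (i : Fin p)
    (hi : i.val = l₁.length) :
    (fun k : Fin p => (l₁ ++ x :: l₂).get (k.cast h.symm)) =
      Function.update (fun k : Fin p => (l₁ ++ 0 :: l₂).get (k.cast h'.symm)) i x := by
  funext k
  rcases eq_or_ne k i with rfl | hk
  · simp [hi, List.getElem_append]
  · rw [Function.update_of_ne hk]
    have hk' : k.val ≠ l₁.length := fun e => hk (Fin.ext (e.trans hi.symm))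
    simp only [List.get_eq_getElem, List.getElem_append, Fin.val_cast]
    split_ifs with hlt
    · rfl
    · simp only [List.getElem_cons]
      rw [dif_neg (by omega), dif_neg (by omega)]

theorem evalLists_linear_left (l₁ l₂ b : List A) :
    ∃ φ : A →ₗ[R] A, ∀ x, evalLists E (l₁ ++ x :: l₂) b = φ x := by
  have h : ∀ x, (l₁ ++ x :: l₂).length = l₁.length + (l₂.length + 1) := by simp
  have key := fun x => (evalLists_eq E (l₁ ++ x :: l₂) b (h x) rfl).trans
    (by rw [get_append_cons l₁ l₂ x (h x) (h 0) ⟨l₁.length, by omega⟩ rfl])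
  exact ⟨{ toFun := _, map_add' := fun x y => by simp, map_smul' := fun c x => by simp }, key⟩

theorem evalLists_linear_right (a l₁ l₂ : List A) :
    ∃ φ : A →ₗ[R] A, ∀ x, evalLists E a (l₁ ++ x :: l₂) = φ x := by
  have h : ∀ x, (l₁ ++ x :: l₂).length = l₁.length + (l₂.length + 1) := by simp
  have key := fun x => (evalLists_eq E a (l₁ ++ x :: l₂) rfl (h x)).trans
    (by rw [get_append_cons l₁ l₂ x (h x) (h 0) ⟨l₁.length, by omega⟩ rfl])
  exact ⟨{ toFun := _, map_add' := fun x y => by simp, map_smul' := fun c x => by simp }, key⟩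

end EvalLists

/-! ### The product `∘` on `BA`. -/

namespace HirschAlgebra

variable {R A N N' : Type*} [CommRing R] [Ring A] [Algebra R A] [AddCommGroup N] [Module R N]
  [AddCommGroup N'] [Module R N'] (H : HirschAlgebra R A)

theorem op_nil_nil : H.op [] [] = 0 := by
  simp [op, evalLists, H.E_left 0]

theorem op_nil_right (a : List A) (h : a.length ≠ 1) : H.op a [] = 0 := by
  simp [op, evalLists, H.E_left _ h]

theorem op_nil_left (b : List A) (h : b.length ≠ 1) : H.op [] b = 0 := by
  simp [op, evalLists, H.E_right _ h]

theorem op_singleton_right (x : A) : H.op [] [x] = x := H.E_zero_one _ _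

theorem op_singleton_left (x : A) : H.op [x] [] = x := H.E_one_zero _ _

theorem op_one_cons (a b : List A) (h : 1 ≤ a.length + b.length) : H.op a (1 :: b) = 0 :=
  H.E_unit_right _ _ (by simp; omega) _ _ ⟨⟨0, by simp⟩, rfl⟩

theorem op_mem {a b : List A} {α β : List ℕ} (ha : List.Forall₂ (fun x n => x ∈ H.gr n) a α)
    (hb : List.Forall₂ (fun x n => x ∈ H.gr n) b β) {n : ℕ}
    (hn : n + a.length + b.length = α.sum + β.sum + 1) : H.op a b ∈ H.gr n := by
  have hα := ha.length_eq
  have hβ := hb.length_eq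
  rw [List.forall₂_iff_get] at ha hb
  refine H.E_mem a.length b.length (fun i => α.get (i.cast hα)) (fun i => β.get (i.cast hβ)) _ _
    (fun i => ha.2 _ i.2 _) (fun i => hb.2 _ i.2 _) n ?_
  have h (γ : List ℕ) (m : ℕ) (h : m = γ.length) : ∑ i : Fin m, γ.get (i.cast h) = γ.sum := by
    subst h
    simp
  rw [h, h, hn]

theorem forall₂_vals (l : List (Letter H.gr)) :
    List.Forall₂ (fun x n => x ∈ H.gr n) (vals l) (l.map fun x => x.bdeg + 1) := by
  induction l with
  | nil => exact .nil
  | cons x l ih => exact .cons x.mem ih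

theorem sum_degrees (l : List (Letter H.gr)) :
    (l.map fun x => x.bdeg + 1).sum = bdeg l + l.length := by
  induction l with
  | nil => rfl
  | cons x l ih => simp [ih]; omega

theorem op_vals_mem (a b : List (Letter H.gr)) :
    H.op (vals a) (vals b) ∈ H.gr (bdeg a + bdeg b + 1) :=
  H.op_mem (H.forall₂_vals a) (H.forall₂_vals b) (by
    simp only [length_vals, sum_degrees]; omega)

theorem op_vals_cons_mem (a b : List (Letter H.gr)) {k : ℕ} {b₀ : A} (hb₀ : b₀ ∈ H.gr k) :
    H.op (vals a) (b₀ :: vals b) ∈ H.gr (bdeg a + k + bdeg b) :=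
  H.op_mem (H.forall₂_vals a) (.cons hb₀ (H.forall₂_vals b)) (by
    simp only [length_vals, sum_degrees, List.length_cons, List.sum_cons]; omega)

/-- Since `E_{0,0} = 0`, the pair of empty blocks may be included, which turns the defining
recursion into an unrestricted sum over splittings. -/
theorem circ_eq (a b : List (Letter H.gr)) :
    H.circ a b = (if a = [] ∧ b = [] then 1 else 0) +
      splitSum a fun a' a'' => splitSum b fun b' b'' => (-1 : R) ^ (bdeg a'' * bdeg b') •
        (barLetter R (H.op (vals a') (vals b')) * H.circ a'' b'') := by
  by_cases hab : a = [] ∧ b = []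
  · obtain ⟨rfl, rfl⟩ := hab
    rw [circ]
    simp [splitSum, op_nil_nil, barLetter_zero]
  · have h : ¬(a.length + b.length = 0) := by
      simpa only [Nat.add_eq_zero_iff, List.length_eq_zero_iff] using hab
    rw [circ, if_neg h, if_neg hab, zero_add]
    simp only [splitSum_eq_sum, Finset.sum_range]
    refine Finset.sum_congr rfl fun i _ => Finset.sum_congr rfl fun j _ => ?_
    split_ifs with hij
    · rfl
    · have hi : i.val = 0 := by omega
      have hj : j.val = 0 := by omega
      simp [hi, hj, op_nil_nil, barLetter_zero]

theorem circ_nil_nil : H.circ [] [] = 1 := by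
  rw [circ]
  simp

-- As `E_{0,q} = 0` for `q ≠ 1`, only the block consisting of the single letter `x` contributes.
omit [Module R N] in
theorem splitSum_nil_left_op (f : A → List (Letter H.gr) → N) (hf : ∀ v, f 0 v = 0)
    (x : Letter H.gr) (l : List (Letter H.gr)) :
    splitSum (x :: l) (fun u v => f (H.op [] (vals u)) v) = f x.val l := by
  have (u v : List (Letter H.gr)) (y : Letter H.gr) : f (H.op [] (vals (x :: y :: u))) v = 0 := by
    rw [op_nil_left _ _ (by simp), hf]
  cases l <;> simp [splitSum, op_nil_nil, hf, this, - vals_cons]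
  all_goals simp [op_singleton_right]

omit [Module R N] in
theorem splitSum_nil_right_op (f : A → List (Letter H.gr) → N) (hf : ∀ v, f 0 v = 0)
    (x : Letter H.gr) (l : List (Letter H.gr)) :
    splitSum (x :: l) (fun u v => f (H.op (vals u) []) v) = f x.val l := by
  have (u v : List (Letter H.gr)) (y : Letter H.gr) : f (H.op (vals (x :: y :: u)) []) v = 0 := by
    rw [op_nil_right _ _ (by simp), hf]
  cases l <;> simp [splitSum, op_nil_nil, hf, this, - vals_cons]
  all_goals simp [op_singleton_left]

theorem circ_nil_left (b : List (Letter H.gr)) : H.circ [] b = barWord R (vals b) := by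
  induction b with
  | nil => exact H.circ_nil_nil
  | cons x b ih =>
    rw [circ_eq]
    simpa [splitSum, ih] using H.splitSum_nil_left_op
      (fun y v => barLetter R y * H.circ [] v) (fun v => by simp [barLetter_zero]) x b

theorem circ_nil_right (a : List (Letter H.gr)) : H.circ a [] = barWord R (vals a) := by
  induction a with
  | nil => exact H.circ_nil_nil
  | cons x a ih =>
    rw [circ_eq]
    simpa [splitSum, ih] using H.splitSum_nil_right_op
      (fun y v => barLetter R y * H.circ v []) (fun v => by simp [barLetter_zero]) x a

theorem linearAt_op_left (l₁ l₂ : List (Letter H.gr)) (b : List A) :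
    LinearAt (fun a => H.op (vals a) b) l₁ l₂ := fun n => by
  obtain ⟨φ, hφ⟩ := evalLists_linear_left H.E (vals l₁) (vals l₂) b
  exact ⟨φ ∘ₗ Submodule.subtype _, fun x => by simp [op, hφ]⟩

theorem linearAt_op_right (a : List A) (l₁ l₂ : List (Letter H.gr)) :
    LinearAt (fun b => H.op a (vals b)) l₁ l₂ := fun n => by
  obtain ⟨φ, hφ⟩ := evalLists_linear_right H.E a (vals l₁) (vals l₂)
  exact ⟨φ ∘ₗ Submodule.subtype _, fun x => by simp [op, hφ]⟩

/-- Either the varying letter lies in the first block, where `E` is multilinear, or it lies in the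
remainder. There the induction applies, because two empty first blocks give the zero letter and
otherwise `l₁` or `b` has become shorter. -/
theorem linearAt_circ_left (l₁ l₂ b : List (Letter H.gr)) :
    LinearAt (fun a => H.circ a b) l₁ l₂ := by
  induction hn : l₁.length + b.length using Nat.strong_induction_on generalizing l₁ b with
  | _ n ih =>
  subst hn
  refine LinearAt.congr (g := fun a => splitSum a fun a' a'' => splitSum b fun b' b'' =>
    (-1 : R) ^ (bdeg a'' * bdeg b') • (barLetter R (H.op (vals a') (vals b')) * H.circ a'' b''))
    ?_ fun x => by rw [circ_eq]; simp
  refine LinearAt.of_splitSum (fun a' a'' ha => LinearAt.splitSum_const _ fun b' b'' hb => ?_)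
    (fun a' a'' ha => LinearAt.splitSum_const _ fun b' b'' hb => ?_)
  · refine LinearAt.bdeg_smul (c := fun m => (-1 : R) ^ (m * bdeg b')) ?_
    by_cases h : a' = [] ∧ b' = []
    · simpa [h, op_nil_nil, barLetter_zero] using LinearAt.zero
    · refine (ih _ ?_ a'' b'' rfl).map (LinearMap.mulLeft R _)
      subst ha hb
      have : 0 < a'.length + b'.length := by
        simpa only [Nat.pos_iff_ne_zero, ne_eq, Nat.add_eq_zero_iff, List.length_eq_zero_iff]
          using h
      simp only [List.length_append]
      omega
  · exact ((H.linearAt_op_left l₁ a' _).map (LinearMap.lsmul R _ _ ∘ₗ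
      LinearMap.mulRight R (H.circ a'' b'') ∘ₗ barLetterₗ R A))

theorem linearAt_circ_right (a l₁ l₂ : List (Letter H.gr)) :
    LinearAt (fun b => H.circ a b) l₁ l₂ := by
  induction hn : a.length + l₁.length using Nat.strong_induction_on generalizing l₁ a with
  | _ n ih =>
  subst hn
  refine LinearAt.congr (g := fun b => splitSum a fun a' a'' => splitSum b fun b' b'' =>
    (-1 : R) ^ (bdeg a'' * bdeg b') • (barLetter R (H.op (vals a') (vals b')) * H.circ a'' b''))
    ?_ fun x => by rw [circ_eq]; simp
  refine LinearAt.splitSum_const _ fun a' a'' ha => LinearAt.of_splitSum (fun b' b'' hb => ?_)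
    (fun b' b'' hb => ?_)
  · refine LinearAt.map (F := LinearMap.lsmul R _ ((-1 : R) ^ (bdeg a'' * bdeg b'))) ?_
    by_cases h : a' = [] ∧ b' = []
    · simpa [h, op_nil_nil, barLetter_zero] using LinearAt.zero
    · refine (ih _ ?_ a'' b'' rfl).map (LinearMap.mulLeft R _)
      subst ha hb
      have : 0 < a'.length + b'.length := by
        simpa only [Nat.pos_iff_ne_zero, ne_eq, Nat.add_eq_zero_iff, List.length_eq_zero_iff]
          using h
      simp only [List.length_append]
      omega
  · exact LinearAt.bdeg_smul (c := fun m => (-1 : R) ^ (bdeg a'' * m))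
      ((H.linearAt_op_right _ l₁ b').map (LinearMap.mulRight R (H.circ a'' b'') ∘ₗ barLetterₗ R A))

/-- The product of `BA` with a fixed word on the right. -/
noncomputable def circWord (b : List (Letter H.gr)) : Bar R A →ₗ[R] Bar R A :=
  wordLift H.isDGA.internal H.gr_zero (fun a => H.circ a b)
    fun l₁ l₂ => H.linearAt_circ_left l₁ l₂ b

theorem circWord_barWord (a b : List (Letter H.gr)) :
    H.circWord b (barWord R (vals a)) = H.circ a b :=
  wordLift_barWord _ _ _ _ a

theorem linearAt_circWord (l₁ l₂ : List (Letter H.gr)) : LinearAt H.circWord l₁ l₂ := by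
  refine LinearAt.of_add_smul (fun n x y => ?_) (fun n c x => ?_)
  · refine bar_hom_ext H.isDGA.internal H.gr_zero fun a => ?_
    obtain ⟨φ, hφ⟩ := H.linearAt_circ_right a l₁ l₂ n
    simp [circWord_barWord, hφ]
  · refine bar_hom_ext H.isDGA.internal H.gr_zero fun a => ?_
    obtain ⟨φ, hφ⟩ := H.linearAt_circ_right a l₁ l₂ n
    simp [circWord_barWord, hφ]

/-- The product of `BA` as a bilinear map. -/
noncomputable def circL : Bar R A →ₗ[R] Bar R A →ₗ[R] Bar R A :=
  (wordLift H.isDGA.internal H.gr_zero H.circWord H.linearAt_circWord).flip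

@[simp] theorem circL_barWord (a b : List (Letter H.gr)) :
    H.circL (barWord R (vals a)) (barWord R (vals b)) = H.circ a b := by
  rw [circL, LinearMap.flip_apply, wordLift_barWord, circWord_barWord]

theorem circL_one_right (x : Bar R A) : H.circL x 1 = x := by
  have : H.circL.flip 1 = LinearMap.id := bar_hom_ext H.isDGA.internal H.gr_zero fun a => by
    simpa [circ_nil_right] using H.circL_barWord a []
  rw [← LinearMap.flip_apply, this, LinearMap.id_apply]

end HirschAlgebra

/-! ### The bar differential on words of homogeneous letters. -/

namespace HirschAlgebra

variable {R A N N' : Type*} [CommRing R] [Ring A] [Algebra R A] [AddCommGroup N] [Module R N]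
  [AddCommGroup N'] [Module R N'] (H : HirschAlgebra R A)

section WordD

/-- The differential of a letter. -/
def dLetter (x : Letter H.gr) : Letter H.gr := ⟨x.bdeg + 1, H.d x.val, H.isDGA.d_mem _ _ x.mem⟩

/-- The product of two letters. -/
def mulLetter (x y : Letter H.gr) : Letter H.gr :=
  ⟨x.bdeg + y.bdeg + 1, x.val * y.val, by
    have := H.isDGA.mul_mem _ _ _ _ x.mem y.mem
    rwa [LinearMap.mul_apply', show x.bdeg + 1 + (y.bdeg + 1) = x.bdeg + y.bdeg + 1 + 1 by omega]
      at this⟩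

/-- The value of a function of words on the word obtained by multiplying the first letter by `x`. -/
def mulHead (x : Letter H.gr) : List (Letter H.gr) → (List (Letter H.gr) → N) → N
  | [], _ => 0
  | y :: l, f => f (H.mulLetter x y :: l)

/-- The value of a function of words of letters on the bar differential of a word. -/
def wordD : List (Letter H.gr) → (List (Letter H.gr) → N) → N
  | [], _ => 0
  | x :: l, f => -f (H.dLetter x :: l) +
      (-1 : R) ^ x.bdeg • (wordD l (fun w => f (x :: w)) - H.mulHead x l f)

theorem wordD_cons (x : Letter H.gr) (l : List (Letter H.gr)) (f : List (Letter H.gr) → N) :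
    H.wordD (x :: l) f = -f (H.dLetter x :: l) +
      (-1 : R) ^ x.bdeg • (H.wordD l (fun w => f (x :: w)) - H.mulHead x l f) := rfl

theorem barD_eq_wordD (l : List (Letter H.gr)) (f : List A → N) :
    barD H.d l f = H.wordD l (fun w => f (vals w)) := by
  induction l generalizing f with
  | nil => rfl
  | cons x l ih =>
    cases l with
    | nil => simp [barD, wordD, mulHead, dLetter]
    | cons y l =>
      rw [barD, ih, wordD_cons H x]
      simp only [mulHead, vals_cons, dLetter, mulLetter, smul_sub]
      abel

/-- The differential raises degree by one, so signs depending on the degree of the argument may be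
replaced by constants under `wordD`. -/
theorem wordD_congr {l : List (Letter H.gr)} {f g : List (Letter H.gr) → N}
    (h : ∀ w, bdeg w = bdeg l + 1 → f w = g w) : H.wordD l f = H.wordD l g := by
  induction l generalizing f g with
  | nil => rfl
  | cons x l ih =>
    have h2 : H.mulHead x l f = H.mulHead x l g := by
      cases l with
      | nil => rfl
      | cons y l => exact h _ (by simp [mulLetter]; omega)
    rw [wordD, wordD, h _ (by simp [dLetter]; omega),
      ih (fun w hw => h (x :: w) (by simp [hw]; omega)), h2]

theorem map_wordD (F : N →ₗ[R] N') (l : List (Letter H.gr)) (f : List (Letter H.gr) → N) :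
    F (H.wordD l f) = H.wordD l (fun w => F (f w)) := by
  induction l generalizing f with
  | nil => exact map_zero F
  | cons x l ih =>
    have h2 : F (H.mulHead x l f) = H.mulHead x l (fun w => F (f w)) := by
      cases l with
      | nil => exact map_zero F
      | cons y l => rfl
    simp [wordD, ih, h2]

/-- Additivity in the function is naturality in the target, applied to addition and the two
projections on `N × N`. -/
theorem wordD_add (l : List (Letter H.gr)) (f g : List (Letter H.gr) → N) :
    H.wordD l (fun w => f w + g w) = H.wordD l f + H.wordD l g := by
  have := H.map_wordD (LinearMap.fst R N N + LinearMap.snd R N N) l (fun w => (f w, g w))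
  have h1 := H.map_wordD (LinearMap.fst R N N) l (fun w => (f w, g w))
  have h2 := H.map_wordD (LinearMap.snd R N N) l (fun w => (f w, g w))
  simp only [LinearMap.add_apply, h1, h2] at this
  exact this.symm

theorem wordD_smul (c : R) (l : List (Letter H.gr)) (f : List (Letter H.gr) → N) :
    H.wordD l (fun w => c • f w) = c • H.wordD l f :=
  (H.map_wordD (LinearMap.lsmul R N c) l f).symm

theorem wordD_splitSum {α : Type*} (l : List (Letter H.gr)) (b : List α)
    (f : List (Letter H.gr) → List α → List α → N) :
    H.wordD l (fun w => splitSum b (f w)) = splitSum b fun u v => H.wordD l fun w => f w u v := by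
  induction b generalizing f with
  | nil => rfl
  | cons x b ih =>
    simp only [splitSum, wordD_add]
    rw [ih fun w u v => f w (x :: u) v]

/-- The bar differential is a coderivation. -/
theorem wordD_coderivation (l : List (Letter H.gr))
    (G : List (Letter H.gr) → List (Letter H.gr) → N) :
    H.wordD l (fun w => splitSum w G) = splitSum l fun u v =>
      H.wordD u (fun w => G w v) + (-1 : R) ^ bdeg u • H.wordD v (G u) := by
  induction l generalizing G with
  | nil => simp [splitSum, wordD]
  | cons x l ih =>
    -- The merged letter cannot be cut: it either lies right of the empty left piece or belongs to a
    -- nonempty left piece.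
    have h2 : H.mulHead x l (fun w => splitSum w G) = H.mulHead x l (G []) +
        splitSum l fun u v => H.mulHead x u fun w => G w v := by
      cases l with
      | nil => simp [mulHead, splitSum]
      | cons y l => simp [mulHead, splitSum]
    rw [wordD_cons, h2]
    simp only [splitSum, wordD_add, ih fun u v => G (x :: u) v]
    simp only [wordD, zero_add, pow_zero, one_smul, bdeg_cons, bdeg_nil, pow_add, mul_smul,
      splitSum_add, splitSum_neg, splitSum_sub, splitSum_smul, smul_add, smul_sub]
    abel

end WordD

/-! ### The differential of `BA` as a linear map, and the exchange of a head letter with a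
coefficient. -/

section Structure

/-- The projection to the component of degree `k`. -/
noncomputable def component (k : ℕ) : A →ₗ[R] A :=
  gradedLift H.isDGA.internal fun j => if j = k then (H.gr j).subtype else 0

theorem component_self {k : ℕ} {x : A} (hx : x ∈ H.gr k) : H.component k x = x := by
  rw [component, gradedLift_apply _ _ hx, if_pos rfl]
  rfl

theorem component_of_ne {j k : ℕ} (h : j ≠ k) {x : A} (hx : x ∈ H.gr j) :
    H.component k x = 0 := by
  rw [component, gradedLift_apply _ _ hx, if_neg h]
  rfl

/-- The sign involution `x ↦ (-1)^|x| x`. -/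
noncomputable def sign : A →ₗ[R] A :=
  gradedLift H.isDGA.internal fun j => (-1 : R) ^ j • (H.gr j).subtype

theorem sign_apply {k : ℕ} {x : A} (hx : x ∈ H.gr k) : H.sign x = (-1 : R) ^ k • x := by
  rw [sign, gradedLift_apply _ _ hx]
  rfl

/-- The identification of the reduced algebra with the part of positive degree. -/
noncomputable def posPart : Reduced R A →ₗ[R] A :=
  reducedLift H.isDGA.internal H.gr_zero
    (fun j => match j with
      | 0 => 0
      | j + 1 => (H.gr (j + 1)).subtype) rfl

theorem posPart_mk {k : ℕ} {x : A} (hx : x ∈ H.gr (k + 1)) :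
    H.posPart (Submodule.Quotient.mk x) = x :=
  reducedLift_mk _ _ _ _ hx

/-- The linear map `a ⊗ [a₁|…] ↦ [a|a₁|…]`. -/
noncomputable def cons (R A : Type*) [CommRing R] [Ring A] [Algebra R A] :
    AcyclicBar R A →ₗ[R] Bar R A :=
  TensorProduct.lift (LinearMap.mul R (Bar R A) ∘ₗ barLetterₗ R A)

@[simp] theorem cons_tmul (a : A) (w : Bar R A) : cons R A (a ⊗ₜ w) = barLetter R a * w := rfl

/-- The linear map `[a₁|a₂|…] ↦ a₁ ⊗ [a₂|…]`, vanishing on `[]`. -/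
noncomputable def uncons : Bar R A →ₗ[R] AcyclicBar R A :=
  TensorAlgebra.leftRec 0 (TensorProduct.mk R A (Bar R A) ∘ₗ H.posPart) 0

@[simp] theorem uncons_one : H.uncons 1 = 0 := TensorAlgebra.leftRec_one _ _ _

theorem uncons_barLetter_mul {k : ℕ} {x : A} (hx : x ∈ H.gr (k + 1)) (w : Bar R A) :
    H.uncons (barLetter R x * w) = x ⊗ₜ w := by
  rw [barLetter, uncons, TensorAlgebra.leftRec_ι_mul]
  simp [H.posPart_mk hx]

/-- Multiplication by elements of `A` from the left on `B(A; A)`. -/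
noncomputable def leftMul (R A : Type*) [CommRing R] [Ring A] [Algebra R A] :
    A →ₗ[R] AcyclicBar R A →ₗ[R] AcyclicBar R A :=
  LinearMap.rTensorHom (Bar R A) ∘ₗ LinearMap.mul R A

@[simp] theorem leftMul_tmul (a b : A) (w : Bar R A) :
    leftMul R A a (b ⊗ₜ w) = (a * b) ⊗ₜ w := rfl

theorem leftMul_mul (a b : A) (z : AcyclicBar R A) :
    leftMul R A (a * b) z = leftMul R A a (leftMul R A b z) := by
  induction z using TensorProduct.induction_on with
  | zero => simp
  | tmul c w => simp [mul_assoc]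
  | add z z' h h' => simp only [map_add, h, h']

/-- The differential of `BA`. -/
noncomputable def barDiff : Bar R A →ₗ[R] Bar R A :=
  TensorAlgebra.leftRec 0
    (((leftMul R A ∘ₗ H.sign ∘ₗ H.posPart).compl₂ H.uncons -
      TensorProduct.mk R A (Bar R A) ∘ₗ H.d ∘ₗ H.posPart).compr₂ (cons R A))
    (-(TensorProduct.mk R A (Bar R A) ∘ₗ H.sign ∘ₗ H.posPart).compr₂ (cons R A))

@[simp] theorem barDiff_one : H.barDiff 1 = 0 := TensorAlgebra.leftRec_one _ _ _

/-- The map `sign` uses the degree `k + 1` of `x`, while the bar differential uses the desuspended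
degree `k`; this accounts for the opposite signs in the definition of `barDiff`. -/
theorem barDiff_barLetter_mul {k : ℕ} {x : A} (hx : x ∈ H.gr (k + 1)) (w : Bar R A) :
    H.barDiff (barLetter R x * w) = -(barLetter R (H.d x) * w) +
      (-1 : R) ^ k • (barLetter R x * H.barDiff w - cons R A (leftMul R A x (H.uncons w))) := by
  rw [barLetter, barDiff, TensorAlgebra.leftRec_ι_mul]
  simp [H.posPart_mk hx, H.sign_apply hx, pow_succ, smul_sub, ← barLetterₗ_apply]
  abel

theorem barDiff_barWord (l : List (Letter H.gr)) :
    H.barDiff (barWord R (vals l)) = H.wordD l (fun w => barWord R (vals w)) := by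
  induction l with
  | nil => simp [wordD]
  | cons x l ih =>
    have h : cons R A (leftMul R A x.val (H.uncons (barWord R (vals l)))) =
        H.mulHead x l (fun w => barWord R (vals w)) := by
      cases l with
      | nil => simp [mulHead]
      | cons y l => simp [mulHead, H.uncons_barLetter_mul y.mem, mulLetter]
    rw [vals_cons, barWord_cons, H.barDiff_barLetter_mul x.mem, ih, h, wordD]
    have := H.map_wordD (LinearMap.mulLeft R (barLetter R x.val)) l fun w => barWord R (vals w)
    simp only [LinearMap.mulLeft_apply] at this
    simp [dLetter, this]

/-- Each first letter `E(a'; b')` has positive degree, so `uncons` returns it unchanged and the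
recursion for `∘` can be read off in `A ⊗ BA`. -/
theorem uncons_circ (a b : List (Letter H.gr)) :
    H.uncons (H.circ a b) = splitSum a fun a' a'' => splitSum b fun b' b'' =>
      (-1 : R) ^ (bdeg a'' * bdeg b') • (H.op (vals a') (vals b')) ⊗ₜ[R] H.circ a'' b'' := by
  rw [circ_eq, map_add]
  have : H.uncons (if a = [] ∧ b = [] then 1 else 0) = 0 := by split_ifs <;> simp
  simp only [this, zero_add, map_splitSum, map_smul, H.uncons_barLetter_mul (H.op_vals_mem _ _)]

theorem twisting_words (a b : List (Letter H.gr)) :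
    H.d (H.op (vals a) (vals b)) = -(H.wordD a fun w => H.op (vals w) (vals b))
      - (-1 : R) ^ bdeg a • (H.wordD b fun w => H.op (vals a) (vals w))
      - splitSum a fun u v => splitSum b fun p q =>
        (-1 : R) ^ (bdeg v * bdeg p + (bdeg u + bdeg p)) •
          (H.op (vals u) (vals p) * H.op (vals v) (vals q)) := by
  have h := H.twisting a b
  rw [nabla, barD_eq_wordD, barD_eq_wordD, cup] at h
  simp only [splitSum_eq_sum]
  rw [← neg_eq_iff_eq_neg, eq_comm] at h
  rw [eq_sub_iff_add_eq, eq_sub_iff_add_eq, eq_neg_iff_add_eq_zero]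
  change _ + (∑ i ∈ _, ∑ j ∈ _, (-1 : R) ^ (bdeg (a.drop i) * bdeg (b.take j) +
    (bdeg (a.take i) + bdeg (b.take j))) • (evalLists H.E (vals (a.take i)) (vals (b.take j)) *
      evalLists H.E (vals (a.drop i)) (vals (b.drop j)))) + _ + _ = 0
  rw [h]
  simp only [op]
  abel

end Structure

end HirschAlgebra

/-! ### The product `∘` is a chain map. -/

/-- Coassociativity of the coproduct of `BA ⊗ BA`. -/
theorem splitSum_assoc₂ {α β N : Type*} [AddCommMonoid N] (a : List α) (b : List β)
    (F : List α → List α → List α → List β → List β → List β → N) :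
    (splitSum a fun a' w => splitSum b fun b' r => splitSum a' fun u v => splitSum b' fun p q =>
      F u v w p q r) =
    splitSum a fun u a' => splitSum b fun p b' => splitSum a' fun v w => splitSum b' fun q r =>
      F u v w p q r := by
  have h1 (a' w : List α) := splitSum_comm a' b fun u v b' r => splitSum b' fun p q => F u v w p q r
  have h2 (u a' : List α) := splitSum_comm a' b fun v w p b' => splitSum b' fun q r => F u v w p q r
  have h3 := splitSum_assoc a fun u v w => splitSum b fun b' r => splitSum b' fun p q => F u v w p q r
  simp only [← h1, ← h2, h3]
  have h4 (u v w : List α) := splitSum_assoc b fun p q r => F u v w p q r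
  simp only [h4]

namespace HirschAlgebra

variable {R A N N' : Type*} [CommRing R] [Ring A] [Algebra R A] [AddCommGroup N] [Module R N]
  [AddCommGroup N'] [Module R N'] (H : HirschAlgebra R A)

theorem mul_wordD (x : Bar R A) (l : List (Letter H.gr)) (f : List (Letter H.gr) → Bar R A) :
    x * H.wordD l f = H.wordD l fun w => x * f w :=
  H.map_wordD (LinearMap.mulLeft R x) l f

theorem wordD_mul (x : Bar R A) (l : List (Letter H.gr)) (f : List (Letter H.gr) → Bar R A) :
    H.wordD l f * x = H.wordD l fun w => f w * x :=
  H.map_wordD (LinearMap.mulRight R x) l f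

/-- The terms of the twisting equation containing products cancel in the bar differential. -/
theorem circ_cup_cancel (a b : List (Letter H.gr)) :
    (splitSum a fun a' a'' => splitSum b fun b' b'' => (-1 : R) ^ (bdeg a'' * bdeg b') •
      (barLetter R (splitSum a' fun u v => splitSum b' fun p q =>
        (-1 : R) ^ (bdeg v * bdeg p + (bdeg u + bdeg p)) •
          (H.op (vals u) (vals p) * H.op (vals v) (vals q))) * H.circ a'' b'')) =
    splitSum a fun a' a'' => splitSum b fun b' b'' =>
      (-1 : R) ^ (bdeg a'' * bdeg b' + (bdeg a' + bdeg b')) •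
        cons R A (leftMul R A (H.op (vals a') (vals b')) (H.uncons (H.circ a'' b''))) := by
  -- The common summand over cuts into three pieces: the left side cuts the first pair of blocks
  -- again, the right side cuts the second pair.
  let F (u v w p q r : List (Letter H.gr)) : Bar R A :=
    (-1 : R) ^ (bdeg w * (bdeg p + bdeg q) + (bdeg v * bdeg p + (bdeg u + bdeg p))) •
      (barLetter R (H.op (vals u) (vals p) * H.op (vals v) (vals q)) * H.circ w r)
  have h1 : ∀ a' a'' b' b'' : List (Letter H.gr), (-1 : R) ^ (bdeg a'' * bdeg b') •
      (barLetter R (splitSum a' fun u v => splitSum b' fun p q =>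
        (-1 : R) ^ (bdeg v * bdeg p + (bdeg u + bdeg p)) •
          (H.op (vals u) (vals p) * H.op (vals v) (vals q))) * H.circ a'' b'') =
      splitSum a' fun u v => splitSum b' fun p q => F u v a'' p q b'' := by
    intro a' a'' b' b''
    change (LinearMap.lsmul R (Bar R A) ((-1 : R) ^ (bdeg a'' * bdeg b')) ∘ₗ
      LinearMap.mulRight R (H.circ a'' b'') ∘ₗ barLetterₗ R A) _ = _
    rw [map_splitSum]
    refine splitSum_congr fun u v ha => ?_
    rw [map_splitSum]
    refine splitSum_congr fun p q hb => ?_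
    subst ha hb
    simp only [F, LinearMap.comp_apply, map_smul, LinearMap.mulRight_apply, barLetterₗ_apply,
      LinearMap.lsmul_apply, smul_smul, ← pow_add]
    congr 1
    rw [bdeg_append]
    ring
  have h2 : ∀ a' a'' b' b'' : List (Letter H.gr),
      (-1 : R) ^ (bdeg a'' * bdeg b' + (bdeg a' + bdeg b')) •
        cons R A (leftMul R A (H.op (vals a') (vals b')) (H.uncons (H.circ a'' b''))) =
      splitSum a'' fun v w => splitSum b'' fun q r => F a' v w b' q r := by
    intro a' a'' b' b''
    rw [uncons_circ]
    simp only [map_splitSum, map_smul, leftMul_tmul, cons_tmul, ← splitSum_smul, smul_smul,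
      ← pow_add]
    refine splitSum_congr fun v w ha => splitSum_congr fun q r hb => ?_
    subst ha hb
    simp only [F]
    congr 1
    rw [bdeg_append]
    ring
  simp only [h1, h2]
  exact splitSum_assoc₂ a b F

/-- The product of `BA` is a chain map, on words. -/
theorem barDiff_circ (a b : List (Letter H.gr)) :
    H.barDiff (H.circ a b) = (H.wordD a fun w => H.circ w b) +
      (-1 : R) ^ bdeg a • H.wordD b fun w => H.circ a w := by
  induction hn : a.length + b.length using Nat.strong_induction_on generalizing a b with
  | _ n ih =>
  subst hn
  let e (u p : List (Letter H.gr)) : Bar R A := barLetter R (H.op (vals u) (vals p))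
  -- For `u = p = []` the remainder is not shorter, but then the letter `[E(;)]` is zero and the
  -- induction hypothesis is not needed.
  have he (u v p q : List (Letter H.gr)) (ha : u ++ v = a) (hb : p ++ q = b) :
      e u p * H.barDiff (H.circ v q) = e u p * ((H.wordD v fun w => H.circ w q) +
      (-1 : R) ^ bdeg v • H.wordD q fun w => H.circ v w) := by
    by_cases h : u = [] ∧ p = []
    · simp [e, h, op_nil_nil, barLetter_zero]
    · rw [ih _ ?_ v q rfl]
      subst ha hb
      have : 0 < u.length + p.length := by
        simpa only [Nat.pos_iff_ne_zero, ne_eq, Nat.add_eq_zero_iff, List.length_eq_zero_iff]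
          using h
      simp only [List.length_append]
      omega
  have h0 : H.barDiff (if a = [] ∧ b = [] then 1 else 0) = 0 := by split_ifs <;> simp
  have ha : (H.wordD a fun w => H.circ w b) = splitSum a fun u v => splitSum b fun p q =>
      (-1 : R) ^ (bdeg v * bdeg p) • ((H.wordD u fun w => e w p) * H.circ v q +
        (-1 : R) ^ (bdeg u + bdeg p) • (e u p * H.wordD v fun w => H.circ w q)) := by
    rw [H.wordD_congr (g := fun w => splitSum w fun u v => splitSum b fun p q =>
      (-1 : R) ^ (bdeg v * bdeg p) • (e u p * H.circ v q)) fun w hw => ?_]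
    · rw [wordD_coderivation]
      refine splitSum_congr fun u v _ => ?_
      rw [wordD_splitSum, wordD_splitSum, ← splitSum_smul, ← splitSum_add]
      refine splitSum_congr fun p q _ => ?_
      rw [wordD_smul, smul_add, wordD_mul, mul_wordD]
      simp only [← wordD_smul]
      congr 1
      refine H.wordD_congr fun w hw => ?_
      rw [hw, smul_smul, smul_smul, ← pow_add, ← pow_add]
      congr 1
      apply neg_one_pow_congr
      simp only [Nat.even_add, Nat.even_mul]
      tauto
    -- Words in the differential have positive degree, hence are nonempty, so the constant term of
    -- `circ_eq` is absent.
    · rw [circ_eq, if_neg, zero_add]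
      rintro ⟨rfl, -⟩
      simp at hw
  have hb : (-1 : R) ^ bdeg a • (H.wordD b fun w => H.circ a w) =
      splitSum a fun u v => splitSum b fun p q =>
      (-1 : R) ^ (bdeg v * bdeg p) • ((-1 : R) ^ bdeg u • ((H.wordD p fun w => e u w) * H.circ v q)
        + (-1 : R) ^ (bdeg u + bdeg p) •
          (e u p * (-1 : R) ^ bdeg v • H.wordD q fun w => H.circ v w)) := by
    rw [H.wordD_congr (g := fun w => splitSum a fun u v => splitSum w fun p q =>
      (-1 : R) ^ (bdeg v * bdeg p) • (e u p * H.circ v q)) fun w hw => ?_]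
    · rw [wordD_splitSum, ← splitSum_smul]
      refine splitSum_congr fun u v ha => ?_
      subst ha
      rw [wordD_coderivation, ← splitSum_smul]
      refine splitSum_congr fun p q _ => ?_
      rw [wordD_smul, smul_add, smul_add, wordD_mul, mul_smul_comm, mul_wordD]
      simp only [← wordD_smul, smul_smul, ← pow_add]
      congr 1 <;>
      · refine H.wordD_congr fun w hw => ?_
        try rw [hw]
        congr 1
        apply neg_one_pow_congr
        simp only [bdeg_append, Nat.even_add, Nat.even_mul]
        tauto
    · rw [circ_eq, if_neg, zero_add]
      rintro ⟨-, rfl⟩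
      simp at hw
  rw [ha, hb, circ_eq, map_add, h0, zero_add, ← splitSum_add, ← sub_eq_zero]
  simp only [← splitSum_add, map_splitSum, map_smul]
  -- The two sides agree only after summation: term by term they differ by the summands of this
  -- vanishing difference.
  have hc := sub_eq_zero.2 (H.circ_cup_cancel a b)
  rw [← splitSum_sub] at hc ⊢
  rw [← hc]
  refine splitSum_congr fun u v hu => ?_
  rw [← splitSum_sub, ← splitSum_sub]
  refine splitSum_congr fun p q hp => ?_
  -- The twisting equation supplies the differentials of the two blocks, and the quadratic terms to
  -- be cancelled.
  have hd : barLetter R (H.d (H.op (vals u) (vals p))) = -(H.wordD u fun w => e w p) -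
      (-1 : R) ^ bdeg u • (H.wordD p fun w => e u w) -
      barLetter R (splitSum u fun u v => splitSum p fun p q =>
        (-1 : R) ^ (bdeg v * bdeg p + (bdeg u + bdeg p)) •
          (H.op (vals u) (vals p) * H.op (vals v) (vals q))) := by
    rw [twisting_words, ← barLetterₗ_apply, map_sub, map_sub, map_neg, map_smul, map_wordD,
      map_wordD]
    rfl
  have he' := he u v p q hu hp
  simp only [e] at he' hd ⊢
  rw [H.barDiff_barLetter_mul (H.op_vals_mem u p), he', hd, pow_add _ (bdeg v * bdeg p)]
  simp only [sub_mul, neg_mul, mul_add, smul_add, smul_sub, smul_neg, mul_smul, smul_mul_assoc,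
    neg_sub]
  abel

end HirschAlgebra

/-! ### The differential and the multiplication of `B(A; A)`, and the Leibniz rule. -/

theorem linearAt_barWord {R A : Type*} [CommRing R] [Ring A] [Algebra R A]
    {gr : ℕ → Submodule R A} (l₁ l₂ : List (Letter gr)) :
    LinearAt (fun l => barWord R (vals l)) l₁ l₂ := fun n =>
  ⟨LinearMap.mulLeft R (barWord R (vals l₁)) ∘ₗ LinearMap.mulRight R (barWord R (vals l₂)) ∘ₗ
    barLetterₗ R A ∘ₗ (gr (n + 1)).subtype, fun x => by simp [barWord]⟩

namespace HirschAlgebra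

variable {R A N : Type*} [CommRing R] [Ring A] [Algebra R A] [AddCommGroup N] [Module R N]
  (H : HirschAlgebra R A)

theorem hom_ext_bar {f g : Bar R A →ₗ[R] N}
    (h : ∀ l : List (Letter H.gr), f (barWord R (vals l)) = g (barWord R (vals l))) : f = g :=
  bar_hom_ext H.isDGA.internal H.gr_zero h

theorem hom_ext_acyclicBar {f g : AcyclicBar R A →ₗ[R] N}
    (h : ∀ k, ∀ a ∈ H.gr k, ∀ l : List (Letter H.gr),
      f (a ⊗ₜ barWord R (vals l)) = g (a ⊗ₜ barWord R (vals l))) : f = g :=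
  acyclicBar_hom_ext H.isDGA.internal H.gr_zero h

/-- The endomorphism of `BA` scaling the words of degree `n` by `c n`. -/
noncomputable def wordScale (c : ℕ → R) : Bar R A →ₗ[R] Bar R A :=
  wordLift H.isDGA.internal H.gr_zero (fun l => c (bdeg l) • barWord R (vals l))
    fun l₁ l₂ => (linearAt_barWord l₁ l₂).bdeg_smul c

theorem wordScale_barWord (c : ℕ → R) (l : List (Letter H.gr)) :
    H.wordScale c (barWord R (vals l)) = c (bdeg l) • barWord R (vals l) :=
  wordLift_barWord _ _ _ _ l

/-- The sign involution `w ↦ (-1)^|w| w` of `BA`. -/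
noncomputable def barSign : Bar R A →ₗ[R] Bar R A := H.wordScale fun n => (-1) ^ n

theorem barSign_barWord (l : List (Letter H.gr)) :
    H.barSign (barWord R (vals l)) = (-1 : R) ^ bdeg l • barWord R (vals l) :=
  H.wordScale_barWord _ l

theorem barSign_barDiff_barWord (l : List (Letter H.gr)) :
    H.barSign (H.barDiff (barWord R (vals l))) =
      -((-1 : R) ^ bdeg l • H.barDiff (barWord R (vals l))) := by
  rw [barDiff_barWord, map_wordD, ← neg_smul, ← wordD_smul]
  refine H.wordD_congr fun w hw => ?_
  rw [barSign_barWord, hw, pow_succ, mul_neg_one]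

theorem barDiff_circL (a : List (Letter H.gr)) (y : Bar R A) :
    H.barDiff (H.circL (barWord R (vals a)) y) = H.circL (H.barDiff (barWord R (vals a))) y +
      (-1 : R) ^ bdeg a • H.circL (barWord R (vals a)) (H.barDiff y) := by
  have : H.barDiff ∘ₗ H.circL (barWord R (vals a)) = H.circL (H.barDiff (barWord R (vals a))) +
      (-1 : R) ^ bdeg a • H.circL (barWord R (vals a)) ∘ₗ H.barDiff := by
    refine H.hom_ext_bar fun b => ?_
    simp only [LinearMap.comp_apply, LinearMap.add_apply, LinearMap.smul_apply, circL_barWord,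
      barDiff_circ, barDiff_barWord, map_wordD]
    congr 1
    have := H.map_wordD (H.circL.flip (barWord R (vals b))) a fun w => barWord R (vals w)
    rw [← H.map_wordD H.circL]
    simpa only [LinearMap.flip_apply, circL_barWord] using this.symm
  exact LinearMap.congr_fun this y

theorem one_mem_gr : (1 : A) ∈ H.gr 0 := H.isDGA.one_mem

theorem d_one : H.d 1 = 0 := by
  have := H.isDGA.leibniz 0 1 1 H.one_mem_gr
  simpa using this

/-- The differential of `B(A; A)`. -/
noncomputable def acyclicDiff : AcyclicBar R A →ₗ[R] AcyclicBar R A :=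
  LinearMap.rTensor (Bar R A) H.d + TensorProduct.map H.sign H.barDiff -
    TensorProduct.lift ((leftMul R A ∘ₗ H.sign).compl₂ H.uncons)

theorem acyclicDiff_tmul {k : ℕ} {a : A} (ha : a ∈ H.gr k) (w : Bar R A) :
    H.acyclicDiff (a ⊗ₜ w) = H.d a ⊗ₜ w +
      (-1 : R) ^ k • (a ⊗ₜ[R] H.barDiff w - leftMul R A a (H.uncons w)) := by
  simp [acyclicDiff, H.sign_apply ha, smul_sub, TensorProduct.smul_tmul', add_sub_assoc]

theorem acyclicDiff_one_tmul (w : Bar R A) :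
    H.acyclicDiff (1 ⊗ₜ w) = 1 ⊗ₜ H.barDiff w - H.uncons w := by
  have : leftMul R A 1 (H.uncons w) = H.uncons w := by
    induction H.uncons w using TensorProduct.induction_on with
    | zero => simp
    | tmul a w => simp
    | add z z' h h' => rw [map_add, h, h']
  rw [H.acyclicDiff_tmul H.one_mem_gr, d_one, this]
  simp

theorem mul_mem_gr {i j : ℕ} {a b : A} (ha : a ∈ H.gr i) (hb : b ∈ H.gr j) :
    a * b ∈ H.gr (i + j) := H.isDGA.mul_mem _ _ _ _ ha hb

theorem isAcyclicBarDifferential_acyclicDiff : H.IsAcyclicBarDifferential H.acyclicDiff := by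
  intro k a₀ ha₀
  refine ⟨?_, fun a₁ a => ?_⟩
  · rw [H.acyclicDiff_tmul ha₀]
    simp
  · rw [H.acyclicDiff_tmul ha₀, barDiff_barWord, barD_eq_wordD, vals_cons, barWord_cons,
      H.uncons_barLetter_mul a₁.mem, leftMul_tmul, smul_sub, add_sub_assoc]

/-- `B(A; A)` is a left dg `A`-module, which reduces later identities to the coefficient `1`. -/
theorem acyclicDiff_leftMul {k : ℕ} {a : A} (ha : a ∈ H.gr k) (z : AcyclicBar R A) :
    H.acyclicDiff (leftMul R A a z) =
      leftMul R A (H.d a) z + (-1 : R) ^ k • leftMul R A a (H.acyclicDiff z) := by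
  have : H.acyclicDiff ∘ₗ leftMul R A a =
      leftMul R A (H.d a) + (-1 : R) ^ k • leftMul R A a ∘ₗ H.acyclicDiff := by
    refine H.hom_ext_acyclicBar fun j b hb l => ?_
    have h := H.isDGA.leibniz k a b ha
    simp only [LinearMap.mul_apply'] at h
    simp only [LinearMap.comp_apply, LinearMap.add_apply, LinearMap.smul_apply, leftMul_tmul,
      H.acyclicDiff_tmul (H.mul_mem_gr ha hb), H.acyclicDiff_tmul hb, h, leftMul_mul, map_add,
      map_smul, map_sub, TensorProduct.add_tmul, TensorProduct.smul_tmul', smul_add, smul_smul,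
      pow_add, smul_sub, add_assoc, mul_smul_comm]
  exact LinearMap.congr_fun this z

theorem uncons_cons_leftMul_uncons {k : ℕ} {x : A} (hx : x ∈ H.gr (k + 1))
    (l : List (Letter H.gr)) :
    H.uncons (cons R A (leftMul R A x (H.uncons (barWord R (vals l))))) =
      leftMul R A x (H.uncons (barWord R (vals l))) := by
  cases l with
  | nil => simp
  | cons y l =>
    rw [vals_cons, barWord_cons, H.uncons_barLetter_mul y.mem, leftMul_tmul, cons_tmul,
      H.uncons_barLetter_mul (x := x * y.val) (H.mulLetter ⟨k, x, hx⟩ y).mem]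

/-- Removing the desuspension of the head letter is a map of degree `1`, whence the sign. The
merging of the first two letters in `BA` corresponds to the extra term `a₀a₁ ⊗ [a₂|…]`. -/
theorem acyclicDiff_uncons (w : Bar R A) :
    H.acyclicDiff (H.uncons w) = -H.uncons (H.barDiff w) := by
  have : H.acyclicDiff ∘ₗ H.uncons = -(H.uncons ∘ₗ H.barDiff) := by
    refine H.hom_ext_bar fun l => ?_
    cases l with
    | nil => simp
    | cons x l =>
      simp only [LinearMap.comp_apply, LinearMap.neg_apply, vals_cons, barWord_cons,
        H.uncons_barLetter_mul x.mem, H.acyclicDiff_tmul x.mem, H.barDiff_barLetter_mul x.mem,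
        map_add, map_neg, map_smul, map_sub, H.uncons_cons_leftMul_uncons x.mem,
        H.uncons_barLetter_mul (H.isDGA.d_mem _ _ x.mem),
        pow_succ, mul_neg_one, neg_smul, neg_add, neg_neg]
  exact LinearMap.congr_fun this w

theorem barDiff_cons {k : ℕ} {x : A} (hx : x ∈ H.gr (k + 1)) (w : Bar R A) :
    H.barDiff (cons R A (x ⊗ₜ w)) = -cons R A (H.acyclicDiff (x ⊗ₜ w)) := by
  rw [cons_tmul, H.barDiff_barLetter_mul hx, H.acyclicDiff_tmul hx]
  simp [pow_succ, add_comm]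

theorem barDiff_cons_leftMul_uncons {k : ℕ} {x : A} (hx : x ∈ H.gr (k + 1))
    (l : List (Letter H.gr)) :
    H.barDiff (cons R A (leftMul R A x (H.uncons (barWord R (vals l))))) =
      -cons R A (H.acyclicDiff (leftMul R A x (H.uncons (barWord R (vals l))))) := by
  cases l with
  | nil => simp
  | cons y l =>
    rw [vals_cons, barWord_cons, H.uncons_barLetter_mul y.mem, leftMul_tmul,
      H.barDiff_cons (x := x * y.val) (H.mulLetter ⟨k, x, hx⟩ y).mem]

/-- By induction on the word, all terms involving the head letter are moved between `BA` and `A ⊗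
BA` by `cons` and `uncons`, where the module rule for `acyclicDiff` makes them cancel. -/
theorem barDiff_barDiff (w : Bar R A) : H.barDiff (H.barDiff w) = 0 := by
  have : H.barDiff ∘ₗ H.barDiff = 0 := by
    refine H.hom_ext_bar fun l => ?_
    induction l with
    | nil => simp
    | cons x l ih =>
      simp only [LinearMap.comp_apply, LinearMap.zero_apply] at ih ⊢
      have hd : H.d (H.d x.val) = 0 := H.isDGA.d_d _
      have hs : (-1 : R) ^ x.bdeg * (-1) ^ x.bdeg = 1 := by rw [← mul_pow]; simp
      rw [vals_cons, barWord_cons, H.barDiff_barLetter_mul x.mem]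
      simp only [map_add, map_neg, map_smul, map_sub, H.barDiff_barLetter_mul x.mem,
        H.barDiff_barLetter_mul (H.isDGA.d_mem _ _ x.mem), H.barDiff_cons_leftMul_uncons x.mem,
        H.acyclicDiff_leftMul x.mem, acyclicDiff_uncons, hd, ih, barLetter_zero,
        pow_succ, mul_neg_one, neg_smul, smul_sub, smul_add, smul_neg, neg_add, smul_smul, hs,
        one_smul, mul_zero, zero_mul]
      simp
  exact LinearMap.congr_fun this w

theorem acyclicDiff_acyclicDiff (z : AcyclicBar R A) : H.acyclicDiff (H.acyclicDiff z) = 0 := by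
  have : H.acyclicDiff ∘ₗ H.acyclicDiff = 0 := by
    refine H.hom_ext_acyclicBar fun k a ha l => ?_
    -- From `d(1 ⊗ w) = 1 ⊗ dw - uncons w`, the two terms `uncons (dw)` of the square cancel.
    have h1 : H.acyclicDiff (H.acyclicDiff (1 ⊗ₜ barWord R (vals l))) = 0 := by
      simp [acyclicDiff_one_tmul, acyclicDiff_uncons, barDiff_barDiff]
    have h2 : a ⊗ₜ[R] barWord R (vals l) = leftMul R A a (1 ⊗ₜ barWord R (vals l)) := by simp
    have hd : H.d (H.d a) = 0 := H.isDGA.d_d _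
    rw [LinearMap.comp_apply, h2, H.acyclicDiff_leftMul ha, map_add, map_smul,
      H.acyclicDiff_leftMul ha, H.acyclicDiff_leftMul (H.isDGA.d_mem _ _ ha), h1, hd]
    simp [pow_succ]
  exact LinearMap.congr_fun this z

/-- The right multiplication by elements of `BA` on `B(A; A)`. -/
noncomputable def rightCirc : Bar R A →ₗ[R] AcyclicBar R A →ₗ[R] AcyclicBar R A :=
  LinearMap.lTensorHom A ∘ₗ H.circL.flip

@[simp] theorem rightCirc_tmul (y : Bar R A) (a : A) (w : Bar R A) :
    H.rightCirc y (a ⊗ₜ w) = a ⊗ₜ H.circL w y := rfl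

theorem rightCirc_leftMul (y : Bar R A) (a : A) (z : AcyclicBar R A) :
    H.rightCirc y (leftMul R A a z) = leftMul R A a (H.rightCirc y z) := by
  induction z using TensorProduct.induction_on with
  | zero => simp
  | tmul c w => simp
  | add z z' h h' => simp only [map_add, h, h']

theorem rightCirc_one (z : AcyclicBar R A) : H.rightCirc 1 z = z := by
  induction z using TensorProduct.induction_on with
  | zero => simp
  | tmul c w => simp [circL_one_right]
  | add z z' h h' => simp only [map_add, h, h']

/-- The product of `1 ⊗ w` and an element of `B(A; A)`. -/
noncomputable def wordMul : Bar R A →ₗ[R] AcyclicBar R A →ₗ[R] AcyclicBar R A :=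
  (LinearMap.lTensorHom A ∘ₗ H.circL).compl₂ (LinearMap.rTensor (Bar R A) (H.component 0)) +
    (((H.circL ∘ₗ H.barSign).compr₂ H.uncons).compl₂ (cons R A) -
      (H.rightCirc.flip ∘ₗ H.uncons ∘ₗ H.barSign).compl₂ (cons R A))

/-- The summands are complementary: `component 0` sees only the degree `0` part of `b₀`, while
`[b₀]` vanishes on that part. The sign on `w` comes from moving `uncons`, of degree `1`, past `w`.
-/
theorem wordMul_tmul (w : Bar R A) (b₀ : A) (b : Bar R A) :
    H.wordMul w (b₀ ⊗ₜ b) = H.component 0 b₀ ⊗ₜ H.circL w b +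
      (H.uncons (H.circL (H.barSign w) (barLetter R b₀ * b)) -
        H.rightCirc (barLetter R b₀ * b) (H.uncons (H.barSign w))) := by
  simp [wordMul]

theorem wordMul_one_tmul (w b : Bar R A) : H.wordMul w (1 ⊗ₜ b) = 1 ⊗ₜ H.circL w b := by
  rw [wordMul_tmul, barLetter_one, H.component_self H.one_mem_gr]
  simp

theorem wordMul_tmul_of_pos (w : Bar R A) {k : ℕ} {b₀ : A} (hb₀ : b₀ ∈ H.gr (k + 1))
    (b : Bar R A) : H.wordMul w (b₀ ⊗ₜ b) =
      H.uncons (H.circL (H.barSign w) (barLetter R b₀ * b)) -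
        H.rightCirc (barLetter R b₀ * b) (H.uncons (H.barSign w)) := by
  rw [wordMul_tmul, H.component_of_ne (Nat.succ_ne_zero k) hb₀]
  simp

theorem wordMul_uncons (w y : Bar R A) : H.wordMul w (H.uncons y) =
    H.uncons (H.circL (H.barSign w) y) - H.rightCirc y (H.uncons (H.barSign w)) := by
  have : H.wordMul w ∘ₗ H.uncons = H.uncons ∘ₗ H.circL (H.barSign w) -
      H.rightCirc.flip (H.uncons (H.barSign w)) := by
    refine H.hom_ext_bar fun l => ?_
    cases l with
    | nil => simp [circL_one_right, rightCirc_one]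
    | cons x l =>
      simp only [LinearMap.comp_apply, vals_cons, barWord_cons, H.uncons_barLetter_mul x.mem,
        H.wordMul_tmul_of_pos _ x.mem, LinearMap.sub_apply, LinearMap.flip_apply]
  exact LinearMap.congr_fun this y

/-- The multiplication of `B(A; A)`. -/
noncomputable def twistedMul : AcyclicBar R A →ₗ[R] AcyclicBar R A →ₗ[R] AcyclicBar R A :=
  TensorProduct.lift ((LinearMap.llcomp R _ _ _ ∘ₗ leftMul R A).compl₂ H.wordMul)

@[simp] theorem twistedMul_tmul (a : A) (w : Bar R A) (z : AcyclicBar R A) :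
    H.twistedMul (a ⊗ₜ w) z = leftMul R A a (H.wordMul w z) := rfl

theorem twistedMul_leftMul (a : A) (z z' : AcyclicBar R A) :
    H.twistedMul (leftMul R A a z) z' = leftMul R A a (H.twistedMul z z') := by
  induction z using TensorProduct.induction_on with
  | zero => simp
  | tmul c w => simp [leftMul_mul]
  | add z z' h h' => simp only [map_add, LinearMap.add_apply, h, h']

theorem leftMul_one (z : AcyclicBar R A) : leftMul R A 1 z = z := by
  induction z using TensorProduct.induction_on with
  | zero => simp
  | tmul c w => simp
  | add z z' h h' => simp only [map_add, h, h']

theorem twistedMul_one_tmul (z : AcyclicBar R A) (b : Bar R A) :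
    H.twistedMul z (1 ⊗ₜ b) = H.rightCirc b z := by
  induction z using TensorProduct.induction_on with
  | zero => simp
  | tmul c w => simp [wordMul_one_tmul]
  | add z z' h h' => simp only [map_add, LinearMap.add_apply, h, h']

/-- Right multiplication by `y` fails to be compatible with the differentials because `D(a ⊗ (w ∘
y))` contains the head of `w ∘ y`. That head may come from `w` alone or involve `y`; the latter case
is the extra product term. -/
theorem acyclicDiff_rightCirc_uncons (a : List (Letter H.gr)) (y : Bar R A) :
    H.acyclicDiff (H.rightCirc y (H.uncons (barWord R (vals a)))) =
      H.rightCirc y (H.acyclicDiff (H.uncons (barWord R (vals a)))) -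
      (-1 : R) ^ bdeg a • H.rightCirc (H.barDiff y) (H.uncons (barWord R (vals a))) +
      (-1 : R) ^ bdeg a • H.twistedMul (H.uncons (barWord R (vals a))) (H.uncons y) := by
  cases a with
  | nil => simp
  | cons x l =>
    have hs : (-1 : R) ^ bdeg l * (-1) ^ bdeg l = 1 := by rw [← mul_pow]; simp
    simp only [vals_cons, barWord_cons, H.uncons_barLetter_mul x.mem, rightCirc_tmul,
      H.acyclicDiff_tmul x.mem, barDiff_circL, twistedMul_tmul, wordMul_uncons, barSign_barWord,
      map_add, map_sub, map_neg, map_smul, LinearMap.smul_apply, rightCirc_leftMul, bdeg_cons, pow_add,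
      pow_one, mul_neg_one, neg_mul, neg_smul, smul_sub, smul_add, TensorProduct.tmul_add,
      TensorProduct.tmul_smul, smul_smul, mul_assoc, hs, mul_one]
    abel

theorem acyclicDiff_wordMul (a : List (Letter H.gr)) (z : AcyclicBar R A) :
    H.acyclicDiff (H.wordMul (barWord R (vals a)) z) =
      H.twistedMul (H.acyclicDiff (1 ⊗ₜ barWord R (vals a))) z +
        (-1 : R) ^ bdeg a • H.wordMul (barWord R (vals a)) (H.acyclicDiff z) := by
  have hs : (-1 : R) ^ bdeg a * (-1) ^ bdeg a = 1 := by rw [← mul_pow]; simp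
  have : H.acyclicDiff ∘ₗ H.wordMul (barWord R (vals a)) =
      H.twistedMul (H.acyclicDiff (1 ⊗ₜ barWord R (vals a))) +
        (-1 : R) ^ bdeg a • H.wordMul (barWord R (vals a)) ∘ₗ H.acyclicDiff := by
    refine H.hom_ext_acyclicBar fun k b₀ hb₀ b => ?_
    simp only [LinearMap.comp_apply, LinearMap.add_apply, LinearMap.smul_apply]
    cases k with
    | zero =>
      -- In degree `0` linearity reduces to `b₀ = 1`, where the product is `1 ⊗ (w ∘ b)`.
      rw [H.gr_zero] at hb₀
      obtain ⟨r, rfl⟩ := hb₀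
      rw [Algebra.linearMap_apply, Algebra.algebraMap_eq_smul_one, ← TensorProduct.smul_tmul']
      simp only [map_smul]
      rw [smul_comm _ r, ← smul_add]
      congr 1
      simp only [wordMul_one_tmul, acyclicDiff_one_tmul, barDiff_circL, map_sub,
        LinearMap.sub_apply, twistedMul_one_tmul, rightCirc_tmul, wordMul_uncons,
        barSign_barWord, map_smul, LinearMap.smul_apply, smul_sub, TensorProduct.tmul_add,
        TensorProduct.tmul_smul, smul_smul, hs, one_smul]
      abel
    | succ k =>
      -- In positive degree the right factor lies in the image of `uncons`, so the chain map
      -- property of `∘` and the defect formula above apply.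
      have h : b₀ ⊗ₜ[R] barWord R (vals b) = H.uncons (barLetter R b₀ * barWord R (vals b)) :=
        (H.uncons_barLetter_mul hb₀ _).symm
      rw [h]
      simp only [wordMul_uncons, acyclicDiff_one_tmul, acyclicDiff_uncons,
        acyclicDiff_rightCirc_uncons, barDiff_circL, map_sub, map_neg, map_add,
        LinearMap.sub_apply, LinearMap.neg_apply, twistedMul_tmul, leftMul_one,
        barSign_barWord, barSign_barDiff_barWord, map_smul, LinearMap.smul_apply, smul_sub,
        smul_add, smul_neg, smul_smul, hs, one_smul]
      abel
  exact LinearMap.congr_fun this z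

theorem acyclicDiff_twistedMul {k : ℕ} {a₀ : A} (ha₀ : a₀ ∈ H.gr k) (a : List (Letter H.gr))
    (z : AcyclicBar R A) :
    H.acyclicDiff (H.twistedMul (a₀ ⊗ₜ barWord R (vals a)) z) =
      H.twistedMul (H.acyclicDiff (a₀ ⊗ₜ barWord R (vals a))) z +
        (-1 : R) ^ (k + bdeg a) • H.twistedMul (a₀ ⊗ₜ barWord R (vals a)) (H.acyclicDiff z) := by
  have h : a₀ ⊗ₜ[R] barWord R (vals a) = leftMul R A a₀ (1 ⊗ₜ barWord R (vals a)) := by simp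
  have h1 (z : AcyclicBar R A) : H.twistedMul (1 ⊗ₜ barWord R (vals a)) z =
      H.wordMul (barWord R (vals a)) z := by simp [leftMul_one]
  rw [h, H.acyclicDiff_leftMul ha₀, twistedMul_leftMul, twistedMul_leftMul,
    H.acyclicDiff_leftMul ha₀, h1, h1, acyclicDiff_wordMul]
  simp only [map_add, LinearMap.add_apply, map_smul, LinearMap.smul_apply, twistedMul_leftMul,
    h1, smul_add, smul_smul, pow_add, add_assoc]

end HirschAlgebra

/-! ### The explicit formulas, uniqueness, grading and unit. -/

theorem splitSum_mem {α R N : Type*} [CommRing R] [AddCommGroup N] [Module R N]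
    (S : Submodule R N) {l : List α} {G : List α → List α → N}
    (h : ∀ u v, u ++ v = l → G u v ∈ S) : splitSum l G ∈ S := by
  rw [splitSum_eq_sum]
  exact S.sum_mem fun i _ => h _ _ (List.take_append_drop i l)

theorem splitSum_eq_nil {α N : Type*} [AddCommMonoid N] (l : List α) (G : List α → List α → N)
    (h : ∀ x u v, G (x :: u) v = 0) : splitSum l G = G [] l := by
  cases l with
  | nil => rfl
  | cons x l => simp [splitSum, h]

namespace HirschAlgebra

variable {R A N : Type*} [CommRing R] [Ring A] [Algebra R A] [AddCommGroup N] [Module R N]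
  (H : HirschAlgebra R A)

/-- In degree `0`, normalization kills every term except the one with both first pieces empty. In
positive degree, the expansion of `uncons (a ∘ [b₀|b])` splits by whether `b₀` belongs to the first
block; the terms where it does not are those subtracted in `wordMul`. -/
theorem wordMul_barWord (a : List (Letter H.gr)) {k : ℕ} {b₀ : A} (hb₀ : b₀ ∈ H.gr k)
    (b : List (Letter H.gr)) :
    H.wordMul (barWord R (vals a)) (b₀ ⊗ₜ barWord R (vals b)) =
      splitSum a fun a' a'' => splitSum b fun b' b'' =>
        (-1 : R) ^ (bdeg a' + bdeg a'' * (k + bdeg b')) •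
          H.op (vals a') (b₀ :: vals b') ⊗ₜ[R] H.circ a'' b'' := by
  cases k with
  | zero =>
    rw [H.gr_zero] at hb₀
    obtain ⟨r, rfl⟩ := hb₀
    rw [Algebra.linearMap_apply, Algebra.algebraMap_eq_smul_one]
    have h (a b : List A) : H.op a ((r • 1) :: b) = r • H.op a (1 :: b) := by
      obtain ⟨φ, hφ⟩ := evalLists_linear_right H.E a [] b
      simp only [List.nil_append] at hφ
      rw [op, op, hφ, hφ, map_smul]
    rw [splitSum_eq_nil, splitSum_eq_nil]
    · rw [← TensorProduct.smul_tmul', map_smul, wordMul_one_tmul]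
      simp [op_singleton_right, TensorProduct.smul_tmul']
    · intro x u v
      rw [h, op_one_cons _ _ _ (by simp)]
      simp
    · intro x u v
      have h' (b : List A) : H.op (x.val :: vals u) (1 :: b) = 0 := H.op_one_cons _ _ (by simp; omega)
      simp [h, h']
  | succ k =>
    let x : Letter H.gr := ⟨k, b₀, hb₀⟩
    have h1 : (splitSum a fun a' a'' => H.op (vals a') [] ⊗ₜ[R] H.circ a'' (x :: b)) =
        H.rightCirc (barWord R (vals (x :: b))) (H.uncons (barWord R (vals a))) := by
      cases a with
      | nil => simp [splitSum, op_nil_nil]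
      | cons y a =>
        rw [H.splitSum_nil_right_op (fun z v => z ⊗ₜ[R] H.circ v (x :: b)) (by simp),
          vals_cons y, barWord_cons y.val, H.uncons_barLetter_mul y.mem, rightCirc_tmul,
          circL_barWord]
    have h2 := H.uncons_circ a (x :: b)
    simp only [splitSum, splitSum_add, bdeg_nil, mul_zero, pow_zero, one_smul] at h2
    rw [vals_nil, h1, ← sub_eq_iff_eq_add'] at h2
    have h3 : barLetter R b₀ * barWord R (vals b) = barWord R (vals (x :: b)) := by simp [x]
    rw [H.wordMul_tmul_of_pos _ hb₀, h3, barSign_barWord]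
    simp only [map_smul, LinearMap.smul_apply, circL_barWord]
    rw [← smul_sub, h2, ← splitSum_smul]
    refine splitSum_congr fun a' a'' ha => ?_
    rw [← splitSum_smul]
    refine splitSum_congr fun b' b'' hb => ?_
    subst ha
    -- The factor `(-1)^|a|` supplies the sign of `a'` and turns the desuspended degree of `b₀`,
    -- which moves past `a''`, into its full degree.
    rw [smul_smul, ← pow_add]
    congr 1
    congr 1
    simp only [bdeg_append, bdeg_cons, x]
    ring

theorem isTwistedMul_twistedMul : H.IsTwistedMul H.twistedMul := by
  intro a₀ a k b₀ b hb₀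
  rw [twistedMul_tmul, H.wordMul_barWord a hb₀ b]
  simp only [map_splitSum, map_smul, leftMul_tmul]
  simp only [splitSum_eq_sum]

theorem IsAcyclicBarDifferential.eq {D : AcyclicBar R A →ₗ[R] AcyclicBar R A}
    (hD : H.IsAcyclicBarDifferential D) : D = H.acyclicDiff := by
  refine H.hom_ext_acyclicBar fun k a₀ ha₀ a => ?_
  have h := hD k a₀ ha₀
  have h' := H.isAcyclicBarDifferential_acyclicDiff k a₀ ha₀
  cases a with
  | nil => exact h.1.trans h'.1.symm
  | cons x a => exact (h.2 x a).trans (h'.2 x a).symm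

theorem IsTwistedMul.eq {M : AcyclicBar R A →ₗ[R] AcyclicBar R A →ₗ[R] AcyclicBar R A}
    (hM : H.IsTwistedMul M) : M = H.twistedMul :=
  H.hom_ext_acyclicBar fun _ a₀ _ a => H.hom_ext_acyclicBar fun k b₀ hb₀ b =>
    (hM a₀ a k b₀ b hb₀).trans (H.isTwistedMul_twistedMul a₀ a k b₀ b hb₀).symm

/-- The grading of `BA`. -/
def barGr (n : ℕ) : Submodule R (Bar R A) :=
  Submodule.span R {z | ∃ l : List (Letter H.gr), bdeg l = n ∧ z = barWord R (vals l)}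

theorem barWord_mem (l : List (Letter H.gr)) : barWord R (vals l) ∈ H.barGr (bdeg l) :=
  Submodule.subset_span ⟨l, rfl, rfl⟩

theorem barLetter_mul_mem {k m : ℕ} {x : A} (hx : x ∈ H.gr (k + 1)) {w : Bar R A}
    (hw : w ∈ H.barGr m) : barLetter R x * w ∈ H.barGr (k + m) := by
  have : H.barGr m ≤ (H.barGr (k + m)).comap (LinearMap.mulLeft R (barLetter R x)) := by
    refine Submodule.span_le.2 ?_
    rintro _ ⟨l, rfl, rfl⟩
    exact Submodule.subset_span ⟨⟨k, x, hx⟩ :: l, by simp, by simp⟩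
  exact this hw

theorem tmul_mem {i m : ℕ} {a : A} (ha : a ∈ H.gr i) {w : Bar R A} (hw : w ∈ H.barGr m) :
    a ⊗ₜ[R] w ∈ H.acyclicBarGr (i + m) := by
  have : H.barGr m ≤ (H.acyclicBarGr (i + m)).comap (TensorProduct.mk R A (Bar R A) a) := by
    refine Submodule.span_le.2 ?_
    rintro _ ⟨l, rfl, rfl⟩
    exact Submodule.subset_span ⟨i, a, l, ha, rfl, rfl⟩
  exact this hw

theorem circ_mem (a b : List (Letter H.gr)) : H.circ a b ∈ H.barGr (bdeg a + bdeg b) := by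
  induction hn : a.length + b.length using Nat.strong_induction_on generalizing a b with
  | _ n ih =>
  subst hn
  rw [circ_eq]
  refine add_mem ?_ (splitSum_mem _ fun u v ha => splitSum_mem _ fun p q hb => ?_)
  · split_ifs with h
    · obtain ⟨rfl, rfl⟩ := h
      exact H.barWord_mem []
    · exact zero_mem _
  · refine Submodule.smul_mem _ _ ?_
    by_cases h : u = [] ∧ p = []
    · simp [h, op_nil_nil, barLetter_zero]
    · have : 0 < u.length + p.length := by
        simpa only [Nat.pos_iff_ne_zero, ne_eq, Nat.add_eq_zero_iff, List.length_eq_zero_iff]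
          using h
      have hm := H.barLetter_mul_mem (H.op_vals_mem u p) (ih (v.length + q.length)
        (by subst ha hb; simp only [List.length_append]; omega) v q rfl)
      have hdeg : bdeg u + bdeg p + (bdeg v + bdeg q) = bdeg a + bdeg b := by
        subst ha hb
        simp only [bdeg_append]
        omega
      rwa [hdeg] at hm

/-- Modulo `S` the function vanishes on all words of the relevant degree, and `wordD` commutes with
the quotient map. -/
theorem wordD_mem (S : Submodule R N) {l : List (Letter H.gr)} {f : List (Letter H.gr) → N}
    (h : ∀ w, bdeg w = bdeg l + 1 → f w ∈ S) : H.wordD l f ∈ S := by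
  rw [← Submodule.Quotient.mk_eq_zero, ← Submodule.mkQ_apply, map_wordD,
    -- Zero is written as a value of the zero linear map, so that naturality can extract it from
    -- `wordD`.
    H.wordD_congr (g := fun _ => (0 : N →ₗ[R] N ⧸ S) 0), ← map_wordD, LinearMap.zero_apply]
  intro w hw
  simpa using h w hw

theorem acyclicDiff_mem {n : ℕ} {z : AcyclicBar R A} (hz : z ∈ H.acyclicBarGr n) :
    H.acyclicDiff z ∈ H.acyclicBarGr (n + 1) := by
  have : H.acyclicBarGr n ≤ (H.acyclicBarGr (n + 1)).comap H.acyclicDiff := by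
    refine Submodule.span_le.2 ?_
    rintro _ ⟨i, a, l, ha, rfl, rfl⟩
    rw [SetLike.mem_coe, Submodule.mem_comap, H.acyclicDiff_tmul ha]
    refine add_mem ?_ (Submodule.smul_mem _ _ (sub_mem ?_ ?_))
    · have := H.tmul_mem (H.isDGA.d_mem _ _ ha) (H.barWord_mem l)
      rwa [add_right_comm] at this
    · rw [barDiff_barWord]
      refine H.tmul_mem ha (m := bdeg l + 1) (H.wordD_mem _ fun w hw => ?_)
      rw [← hw]
      exact H.barWord_mem w
    · cases l with
      | nil => simp
      | cons x l =>
        rw [vals_cons, barWord_cons, H.uncons_barLetter_mul x.mem, leftMul_tmul]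
        have := H.tmul_mem (H.mul_mem_gr ha x.mem) (H.barWord_mem l)
        have hdeg : i + (x.bdeg + 1) + bdeg l = i + bdeg (x :: l) + 1 := by
          simp only [bdeg_cons]
          omega
        rwa [hdeg] at this
  exact this hz

theorem twistedMul_mem {m n : ℕ} {y z : AcyclicBar R A} (hy : y ∈ H.acyclicBarGr m)
    (hz : z ∈ H.acyclicBarGr n) : H.twistedMul y z ∈ H.acyclicBarGr (m + n) := by
  have h : Submodule.map₂ H.twistedMul (H.acyclicBarGr m) (H.acyclicBarGr n) ≤
      H.acyclicBarGr (m + n) := by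
    rw [acyclicBarGr, acyclicBarGr, Submodule.map₂_span_span, Submodule.span_le]
    rintro _ ⟨_, ⟨i, a₀, a, ha₀, rfl, rfl⟩, _, ⟨k, b₀, b, hb₀, rfl, rfl⟩, rfl⟩
    simp only [SetLike.mem_coe]
    rw [twistedMul_tmul, H.wordMul_barWord a hb₀ b]
    simp only [map_splitSum, map_smul, leftMul_tmul]
    refine splitSum_mem _ fun a' a'' ha => splitSum_mem _ fun b' b'' hb =>
      Submodule.smul_mem _ _ ?_
    have := H.tmul_mem (H.mul_mem_gr ha₀ (H.op_vals_cons_mem a' b' hb₀)) (H.circ_mem a'' b'')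
    have hdeg : i + (bdeg a' + k + bdeg b') + (bdeg a'' + bdeg b'') =
        i + bdeg a + (k + bdeg b) := by
      subst ha hb
      simp only [bdeg_append]
      omega
    rwa [hdeg] at this
  exact h (Submodule.apply_mem_map₂ _ hy hz)

/-- The projection of `B(A; A)` to the component of degree `n`. -/
noncomputable def acyclicComponent (n : ℕ) : AcyclicBar R A →ₗ[R] AcyclicBar R A :=
  ∑ k ∈ Finset.range (n + 1),
    TensorProduct.map (H.component k) (H.wordScale fun m => if k + m = n then 1 else 0)

theorem acyclicComponent_tmul (n : ℕ) {i : ℕ} {a : A} (ha : a ∈ H.gr i) (l : List (Letter H.gr)) :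
    H.acyclicComponent n (a ⊗ₜ barWord R (vals l)) =
      if i + bdeg l = n then a ⊗ₜ barWord R (vals l) else 0 := by
  rw [acyclicComponent, LinearMap.sum_apply]
  simp only [TensorProduct.map_tmul, wordScale_barWord]
  split_ifs with h
  · rw [Finset.sum_eq_single i]
    · rw [H.component_self ha, if_pos h, one_smul]
    · intro k _ hk
      rw [H.component_of_ne hk.symm ha, TensorProduct.zero_tmul]
    · intro hi
      exact absurd (Finset.mem_range.2 (by omega)) hi
  · refine Finset.sum_eq_zero fun k _ => ?_
    rcases eq_or_ne i k with rfl | hk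
    · simp [h]
    · rw [H.component_of_ne hk ha, TensorProduct.zero_tmul]

theorem isInternal_acyclicBarGr : DirectSum.IsInternal H.acyclicBarGr := by
  refine DirectSum.isInternal_submodule_of_iSupIndep_of_iSup_eq_top ?_ ?_
  · intro n
    rw [Submodule.disjoint_def]
    intro z hz hz'
    -- The projection to degree `n` is the identity on this component and zero on all others, which
    -- gives independence.
    have h1 : H.acyclicBarGr n ≤ LinearMap.eqLocus (H.acyclicComponent n) LinearMap.id := by
      refine Submodule.span_le.2 ?_
      rintro _ ⟨i, a, l, ha, rfl, rfl⟩
      simp [H.acyclicComponent_tmul _ ha]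
    have h2 : ⨆ j, ⨆ (_ : j ≠ n), H.acyclicBarGr j ≤ LinearMap.ker (H.acyclicComponent n) := by
      refine iSup₂_le fun j hj => Submodule.span_le.2 ?_
      rintro _ ⟨i, a, l, ha, rfl, rfl⟩
      simp [H.acyclicComponent_tmul _ ha, hj]
    exact (h1 hz).symm.trans (h2 hz')
  · rw [← Submodule.ker_mkQ (⨆ n, H.acyclicBarGr n), LinearMap.ker_eq_top]
    refine H.hom_ext_acyclicBar fun k a ha l => ?_
    rw [LinearMap.zero_apply, Submodule.mkQ_apply, Submodule.Quotient.mk_eq_zero]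
    exact Submodule.mem_iSup_of_mem _ (H.tmul_mem ha (H.barWord_mem l))

theorem twistedMul_one_left (z : AcyclicBar R A) : H.twistedMul (1 ⊗ₜ[R] 1) z = z := by
  have : H.twistedMul (1 ⊗ₜ[R] 1) = LinearMap.id :=
    H.hom_ext_acyclicBar fun k b₀ hb₀ b => by
      have := H.wordMul_barWord [] hb₀ b
      rw [vals_nil, barWord_nil] at this
      rw [twistedMul_tmul, leftMul_one, this, splitSum, splitSum_eq_nil]
      · simp [op_singleton_right, circ_nil_left]
      · intro x u v
        simp [op_nil_left]
  rw [this, LinearMap.id_apply]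

theorem acyclicDiff_leibniz {n : ℕ} {x : AcyclicBar R A} (hx : x ∈ H.acyclicBarGr n)
    (y : AcyclicBar R A) : H.acyclicDiff (H.twistedMul x y) =
      H.twistedMul (H.acyclicDiff x) y + (-1 : R) ^ n • H.twistedMul x (H.acyclicDiff y) := by
  have h : H.acyclicBarGr n ≤ LinearMap.eqLocus ((H.twistedMul.compr₂ H.acyclicDiff).flip y)
      ((H.twistedMul ∘ₗ H.acyclicDiff).flip y +
        (-1 : R) ^ n • H.twistedMul.flip (H.acyclicDiff y)) := by
    refine Submodule.span_le.2 ?_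
    rintro _ ⟨i, a₀, a, ha₀, rfl, rfl⟩
    exact H.acyclicDiff_twistedMul ha₀ a y
  exact h hx

theorem isDGA_acyclicBar : IsDGA H.acyclicBarGr H.acyclicDiff H.twistedMul (1 ⊗ₜ[R] 1) where
  internal := H.isInternal_acyclicBarGr
  one_mem := by simpa using H.tmul_mem H.one_mem_gr (H.barWord_mem [])
  one_mul := H.twistedMul_one_left
  mul_one z := by rw [twistedMul_one_tmul, rightCirc_one]
  mul_mem _ _ _ _ := H.twistedMul_mem
  d_mem _ _ := H.acyclicDiff_mem
  d_d := H.acyclicDiff_acyclicDiff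
  leibniz _ _ y hx := H.acyclicDiff_leibniz hx y

end HirschAlgebra

theorem mainTheorem9 {R A : Type*} [CommRing R] [Ring A] [Algebra R A]
    (H : HirschAlgebra R A) :
    (∃! D : AcyclicBar R A →ₗ[R] AcyclicBar R A, H.IsAcyclicBarDifferential D) ∧
    (∃! M : AcyclicBar R A →ₗ[R] AcyclicBar R A →ₗ[R] AcyclicBar R A, H.IsTwistedMul M) ∧
    ∀ (D : AcyclicBar R A →ₗ[R] AcyclicBar R A)
      (M : AcyclicBar R A →ₗ[R] AcyclicBar R A →ₗ[R] AcyclicBar R A),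
      H.IsAcyclicBarDifferential D → H.IsTwistedMul M →
        IsDGA H.acyclicBarGr D M (1 ⊗ₜ[R] 1) := by
  refine ⟨⟨H.acyclicDiff, H.isAcyclicBarDifferential_acyclicDiff, fun D hD => hD.eq⟩,
    ⟨H.twistedMul, H.isTwistedMul_twistedMul, fun M hM => hM.eq⟩, fun D M hD hM => ?_⟩
  rw [hD.eq, hM.eq]
  exact H.isDGA_acyclicBar
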